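/- Let $(R,\mathfrak m)$ and $(S,\mathfrak n)$ be one-dimensional Cohen-Macaulay local rings with a common infinite residue field $k$, let $f : R \to k$ and $g : S \to k$ be the canonical surjections, and let $A = R\times_k S = \{(a,b)\in R\times S \mid f(a)=g(b)\}$ be their fiber product, which is again a one-dimensional Cohen-Macaulay local ring. Assume that the total ring of fractions $\mathrm Q(A)$ is a Gorenstein ring and that $A$ admits a canonical module $\mathrm K_A$. Then the following conditions are equivalent. 1. $A$ is a nearly Gorenstein ring. 2. $R$ and $S$ are nearly Gorenstein rings. Here a Cohen-Macaulay local ring $(R,\mathfrak m)$ of dimension $d$ with residue field $k$ is called nearly Gorenstein if it admits a canonical module $\mathrm K_R$ (a finitely generated $R$-module with $\operatorname{Ext}^d_R(k,\mathrm K_R)\cong k$ and $\operatorname{Ext}^i_R(k,\mathrm K_R)=0$ for all $i\ne d$) and $\mathfrak m\subseteq \mathrm{tr}_R(\mathrm K_R)$, where the trace $\mathrm{tr}_R(X)$ of an $R$-module $X$ is the image of the evaluation map $\operatorname{Hom}_R(X,R)\otimes_R X\to R$, $\varphi\otimes x\mapsto \varphi(x)$. -/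

import Mathlib

universe u v

open CategoryTheory

/-- A Noetherian local ring is Cohen-Macaulay if its maximal ideal contains a regular sequence whose
length is the Krull dimension of the ring. -/
structure IsCohenMacaulayLocalRing (R : Type u) [CommRing R] [IsLocalRing R] : Prop where
  noetherian : IsNoetherianRing R
  exists_regular_sequence : ∃ rs : List R, (∀ r ∈ rs, r ∈ IsLocalRing.maximalIdeal R) ∧
    RingTheory.Sequence.IsRegular R rs ∧ ((rs.length : ℕ) : WithBot ℕ∞) = ringKrullDim R

/-- A commutative ring is Gorenstein if it is Noetherian and each of its localizations at a maximal
ideal has finite injective dimension as a module over itself. -/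
structure IsGorensteinRing (R : Type u) [CommRing R] : Prop where
  noetherian : IsNoetherianRing R
  finite_injective_dimension : ∀ (p : Ideal R) [p.IsMaximal], ∃ n : ℕ,
    HasInjectiveDimensionLE (ModuleCat.of (Localization.AtPrime p) (Localization.AtPrime p)) n

/-- A canonical module of a Cohen-Macaulay local ring `R` with residue field `k` and dimension `d`:
a finitely generated `R`-module `C` such that `Ext^i_R(k, C) = 0` for all `i ≠ d` and
`Ext^d_R(k, C) ≅ k`. -/
structure IsCanonicalModule (R : Type u) [CommRing R] [IsLocalRing R]
    (C : Type u) [AddCommGroup C] [Module R C] : Prop where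
  finite : Module.Finite R C
  ext_eq_zero : ∀ i : ℕ, (i : WithBot ℕ∞) ≠ ringKrullDim R →
    Subsingleton (Abelian.Ext.{u} (ModuleCat.of R (IsLocalRing.ResidueField R))
      (ModuleCat.of R C) i)
  ext_dim : ∀ d : ℕ, (d : WithBot ℕ∞) = ringKrullDim R →
    Nonempty (Abelian.Ext.{u} (ModuleCat.of R (IsLocalRing.ResidueField R))
      (ModuleCat.of R C) d ≃ₗ[R] IsLocalRing.ResidueField R)

/-- The local ring `R` admits a canonical module. -/
def HasCanonicalModule (R : Type u) [CommRing R] [IsLocalRing R] : Prop :=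
  ∃ (C : Type u) (_ : AddCommGroup C) (_ : Module R C), IsCanonicalModule R C

/-- The trace of an `R`-module `X`: the image of the evaluation map
`Hom_R(X, R) ⊗_R X → R`, `f ⊗ x ↦ f x`. -/
noncomputable def traceIdeal (R : Type u) [CommRing R] (X : Type v) [AddCommGroup X] [Module R X] :
    Ideal R :=
  LinearMap.range (contractLeft R X)

/-- A (Cohen-Macaulay) local ring is nearly Gorenstein if it admits a canonical module whose trace
contains the maximal ideal. Canonical modules are unique up to isomorphism, and the trace depends
only on the isomorphism class. -/
def IsNearlyGorenstein (R : Type u) [CommRing R] [IsLocalRing R] : Prop :=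
  ∃ (K : Type u) (_ : AddCommGroup K) (_ : Module R K),
    IsCanonicalModule R K ∧ IsLocalRing.maximalIdeal R ≤ traceIdeal R K

/-- The fiber product `{(a, b) ∈ R × S | f a = g b}` of local rings over a field, along surjective
homomorphisms, is a local ring. -/
instance isLocalRing_pullback_of_surjective {R S : Type u} {k : Type v} [CommRing R] [IsLocalRing R]
    [CommRing S] [IsLocalRing S] [Field k] (f : R →+* k) (g : S →+* k) [RingHomSurjective g] :
    IsLocalRing (f.pullback g) :=
  haveI : IsLocalHom g := IsLocalHom.of_surjective g g.surjective
  RingHom.isLocalRing_pullback f g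

/-!
Let `K` be a canonical module of `A = R ×ₖ S`, let `r` and `s` be regular elements of the maximal
ideals of `R` and `S`, and let `a = (r, s)`. The idea is to compare the trace of `K` with the trace of
`C = Hom(R, K)`, the submodule of `K` annihilated by `0 × 𝔪_S`, which is a canonical module of `R`.

All arguments about canonical modules use an elementary description (`IsDualizing`): `C` is finitely
generated, `r` is regular on `C`, and `C/rC` is the injective hull of `k` over `R/r`. That this agrees
with the definition by `Ext` is shown in `IsCanonicalModule.isDualizing` and
`IsDualizing.isCanonicalModule`, through the sequence `0 → 𝔪 → R → k → 0`. Injectivity of `C/rC` and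
Nakayama's lemma give the vanishing of `Ext¹(M, C)` for finitely generated torsion-free `M`
(`IsDualizing.exists_extend_of_lift`). Consequences are that `Hom(R, K)` is a canonical module of `R`
(`IsAnnihilatedPart.isDualizing`) and that the trace of a canonical module does not depend on the
choice of the module (`IsDualizing.exists_surjective`).

Multiplication by `(r, 0)` maps `K` into `C`, and the image represents socle elements of `C/rC`. Suppose
that `R` is not a discrete valuation ring. Then some fraction `b/r ∉ R` satisfies `(b/r) 𝔪 ⊆ 𝔪`. As
`C/rC` is faithful over `R/r` and has a simple socle, the image of `K` is in `rC + R b z` for some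
`z ∈ C`. Hence every map `C → 𝔪` extends to a map `K → 𝔪`, while the values of a map `K → 𝔪` are
combinations of values of its restriction `Θ` to `C` and of values of `(b/r) Θ : C → R`. So the trace
of `C` contains `𝔪` if and only if the trace of `K` contains `𝔪 × 0`. If `R` is a discrete valuation
ring, let `r` be a generator of `𝔪`. Then `C` is isomorphic to `R`, and the trace of `K` contains
`𝔪 × 0`: as `K` is not the direct sum of `Hom(R, K)` and `Hom(S, K)`, the image of `K` in `C` is not in
`rC`, so it contains a generator of `C`. The two directions are `IsFiberProduct.traceIdeal_le_comap` and
`IsFiberProduct.mem_traceIdeal`, and the theorem follows from `𝔪_A = 𝔪_R × 𝔪_S`.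
-/

open IsLocalRing Pointwise

/-! ### Parameters and the elementary description of canonical modules -/

section Parameter

variable {R : Type*} [CommRing R] [IsLocalRing R]

/-- A parameter of a one-dimensional Cohen-Macaulay local ring: a regular element of the maximal
ideal that generates an ideal containing a power of the maximal ideal. -/
structure IsParameter (a : R) : Prop where
  mem : a ∈ maximalIdeal R
  regular : IsSMulRegular R a
  pow_le : ∃ n : ℕ, maximalIdeal R ^ n ≤ Ideal.span {a}

/-- The elementary description of a canonical module `C` of a one-dimensional Cohen-Macaulay local
ring with parameter `a`: `C` is finitely generated and torsion-free, the socle of `C/aC` is simple,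
and `C/aC` is an injective `R/a`-module. Injectivity is expressed through Baer's criterion for the
maximal ideal only, that is, as the vanishing of `Ext¹` over `R/a` of the residue field. -/
structure IsDualizing (a : R) (C : Type*) [AddCommGroup C] [Module R C] : Prop where
  finite : Module.Finite R C
  regular : IsSMulRegular C a
  socle : ∃ σ : C, σ ∉ a • (⊤ : Submodule R C) ∧
    (∀ y ∈ maximalIdeal R, y • σ ∈ a • (⊤ : Submodule R C)) ∧
    ∀ z : C, (∀ y ∈ maximalIdeal R, y • z ∈ a • (⊤ : Submodule R C)) →
      ∃ t : R, z - t • σ ∈ a • (⊤ : Submodule R C)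
  baer : ∀ φ : maximalIdeal R →ₗ[R] QuotSMulTop a C, (∀ h, φ ⟨a, h⟩ = 0) →
    ∃ z : QuotSMulTop a C, ∀ y, φ y = (y : R) • z

end Parameter

/-! ### Factoring linear maps -/

section LinearAlgebra

variable {R M N E : Type*} [CommRing R] [AddCommGroup M] [Module R M] [AddCommGroup N] [Module R N]
  [AddCommGroup E] [Module R E]

lemma mem_smul_top_iff {a : R} {z : M} : z ∈ a • (⊤ : Submodule R M) ↔ ∃ w, a • w = z := by
  simp [Submodule.mem_smul_pointwise_iff_exists]

lemma smul_mem_smul_top (a : R) (z : M) : a • z ∈ a • (⊤ : Submodule R M) :=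
  mem_smul_top_iff.2 ⟨z, rfl⟩

lemma exists_linearMap_range_of_ker_le (p : N →ₗ[R] M) (q : N →ₗ[R] E)
    (h : LinearMap.ker p ≤ LinearMap.ker q) :
    ∃ ψ : LinearMap.range p →ₗ[R] E, ∀ x, ψ ⟨p x, x, rfl⟩ = q x := by
  refine ⟨(LinearMap.ker p).liftQ q h ∘ₗ p.quotKerEquivRange.symm.toLinearMap, fun x => ?_⟩
  have : p.quotKerEquivRange.symm ⟨p x, x, rfl⟩ = (LinearMap.ker p).mkQ x := by
    rw [LinearEquiv.symm_apply_eq]; rfl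
  simp [this]

lemma exists_linearMap_of_surjective_of_ker_le (p : N →ₗ[R] M) (hp : Function.Surjective p)
    (q : N →ₗ[R] E) (h : LinearMap.ker p ≤ LinearMap.ker q) :
    ∃ ψ : M →ₗ[R] E, ∀ x, ψ (p x) = q x := by
  obtain ⟨ψ, hψ⟩ := exists_linearMap_range_of_ker_le p q h
  exact ⟨ψ ∘ₗ LinearMap.codRestrict _ LinearMap.id
    (fun m => by obtain ⟨x, rfl⟩ := hp m; exact ⟨x, rfl⟩), fun x => hψ x⟩

lemma exists_eq_smul_of_forall_mem {a : R} (ha : IsSMulRegular M a) (f : N →ₗ[R] M)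
    (hf : ∀ n, f n ∈ a • (⊤ : Submodule R M)) : ∃ χ : N →ₗ[R] M, ∀ n, f n = a • χ n := by
  have hf' : ∀ n, f n ∈ LinearMap.range (LinearMap.lsmul R M a) := fun n => by
    obtain ⟨w, hw⟩ := mem_smul_top_iff.1 (hf n); exact ⟨w, hw⟩
  let e := LinearEquiv.ofInjective (LinearMap.lsmul R M a) ha
  refine ⟨e.symm.toLinearMap ∘ₗ LinearMap.codRestrict _ f hf', fun n => ?_⟩
  have : (e (e.symm ⟨f n, hf' n⟩) : M) = f n := by rw [e.apply_symm_apply]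
  exact this.symm

end LinearAlgebra

/-! ### Extending and lifting maps into a canonical module -/

section Extension

variable {R : Type*} [CommRing R] [IsLocalRing R] {a : R}
  {M C : Type*} [AddCommGroup M] [Module R M] [AddCommGroup C] [Module R C]

lemma IsParameter.exists_notMem_forall_smul_mem (ha : IsParameter a) {N : Submodule R M}
    (hN : N ≠ ⊤) (haN : ∀ x : M, a • x ∈ N) :
    ∃ x ∉ N, ∀ y ∈ maximalIdeal R, y • x ∈ N := by
  classical
  have hex : ∃ n : ℕ, maximalIdeal R ^ n • (⊤ : Submodule R M) ≤ N := by
    obtain ⟨n, hn⟩ := ha.pow_le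
    refine ⟨n, (Submodule.smul_mono_left hn).trans (Submodule.smul_le.2 fun r hr x _ => ?_)⟩
    obtain ⟨c, rfl⟩ := Ideal.mem_span_singleton'.1 hr
    rw [mul_smul]
    exact N.smul_mem _ (haN x)
  obtain ⟨k, hk⟩ : ∃ k, Nat.find hex = k + 1 := by
    refine Nat.exists_eq_succ_of_ne_zero fun h0 => hN ?_
    have := Nat.find_spec hex
    rw [h0, pow_zero, Ideal.one_eq_top, Submodule.top_smul] at this
    exact top_le_iff.1 this
  have h1 := Nat.find_min hex (m := k) (by omega)
  obtain ⟨x, hx, hxN⟩ := SetLike.not_le_iff_exists.1 h1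
  refine ⟨x, hxN, fun y hy => Nat.find_spec hex ?_⟩
  rw [hk, pow_succ', Submodule.mul_smul]
  exact Submodule.smul_mem_smul hy hx

/-- Every nonzero element of `C/aC` has a nonzero multiple in the socle. -/
lemma IsParameter.exists_smul_mem_socle (ha : IsParameter a) {z : C}
    (hz : z ∉ a • (⊤ : Submodule R C)) :
    ∃ t : R, t • z ∉ a • (⊤ : Submodule R C) ∧
      ∀ y ∈ maximalIdeal R, y • t • z ∈ a • (⊤ : Submodule R C) := by
  let I : Ideal R := (a • (⊤ : Submodule R C)).comap (LinearMap.toSpanSingleton R C z)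
  have hI : I ≠ ⊤ := fun h => hz (by
    have : (1 : R) ∈ I := h ▸ Submodule.mem_top
    simpa [I] using this)
  obtain ⟨t, ht, ht'⟩ := ha.exists_notMem_forall_smul_mem hI (fun x => by
    simp only [I, Submodule.mem_comap, LinearMap.toSpanSingleton_apply, smul_assoc]
    exact smul_mem_smul_top _ _)
  refine ⟨t, by simpa [I] using ht, fun y hy => ?_⟩
  have := ht' y hy
  simp only [I, Submodule.mem_comap, LinearMap.toSpanSingleton_apply, smul_assoc] at this
  exact this

/-- Injectivity of `C/aC` over `R/a`, in terms of `R`-modules: a map `N → C/aC` on a submodule of a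
finitely generated module `M` extends to `M` as soon as it vanishes on `N ∩ aM`. -/
lemma IsDualizing.exists_extend_quotient [IsNoetherianRing R] [Module.Finite R M]
    (ha : IsParameter a) (hC : IsDualizing a C) (N : Submodule R M) (φ : N →ₗ[R] QuotSMulTop a C)
    (hφ : ∀ n : N, (n : M) ∈ a • (⊤ : Submodule R M) → φ n = 0) :
    ∃ ψ : M →ₗ[R] QuotSMulTop a C, ∀ n : N, ψ n = φ n := by
  induction N using IsNoetherian.induction with
  | hgt N ih =>
  by_cases hN : N = ⊤
  · subst hN
    exact ⟨φ ∘ₗ Submodule.topEquiv.symm.toLinearMap, fun n => rfl⟩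
  -- It suffices to extend `φ` to `N + Rx` for some `x ∉ N`.
  have step : ∀ (x : M) (z : QuotSMulTop a C), x ∉ N →
      (∀ (n : N) (t : R), (n : M) + t • x ∈ a • (⊤ : Submodule R M) → φ n + t • z = 0) →
      ∃ ψ : M →ₗ[R] QuotSMulTop a C, ∀ n : N, ψ n = φ n := by
    intro x z hx hvan
    obtain ⟨φ', hφ'⟩ := exists_linearMap_range_of_ker_le
      (N.subtype.coprod (LinearMap.toSpanSingleton R M x))
      (φ.coprod (LinearMap.toSpanSingleton R _ z)) (by
        rintro ⟨n, t⟩ h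
        have h' : (n : M) + t • x = 0 := by simpa using h
        simpa using hvan n t (h' ▸ Submodule.zero_mem _))
    have hle : N ≤ LinearMap.range (N.subtype.coprod (LinearMap.toSpanSingleton R M x)) :=
      fun n hn => ⟨(⟨n, hn⟩, 0), by simp⟩
    obtain ⟨ψ, hψ⟩ := ih _ (lt_of_le_of_ne hle fun h => hx (h ▸ ⟨(0, 1), by simp⟩)) φ' (by
      rintro ⟨-, ⟨n, t⟩, rfl⟩ h
      rw [hφ']
      simpa using hvan n t (by simpa using h))
    refine ⟨ψ, fun n => ?_⟩
    have := hφ' (n, 0)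
    simp only [LinearMap.coprod_apply, map_zero, add_zero, Submodule.coe_subtype] at this
    rw [← this, ← hψ]
  by_cases haN : ∀ x : M, a • x ∈ N
  · obtain ⟨x, hx, hmx⟩ := ha.exists_notMem_forall_smul_mem hN haN
    obtain ⟨z, hz⟩ := hC.baer (φ ∘ₗ LinearMap.codRestrict N
      (LinearMap.toSpanSingleton R M x ∘ₗ (maximalIdeal R).subtype) (fun y => hmx y y.2))
      (fun h => hφ _ (smul_mem_smul_top a x))
    refine step x z hx fun n t h => ?_
    obtain ⟨w, hw⟩ := mem_smul_top_iff.1 h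
    have hN' : (n : M) + t • x ∈ N := hw ▸ haN w
    have htx : t • x ∈ N := (N.add_mem_iff_right n.2).1 hN'
    have ht : t ∈ maximalIdeal R := by
      by_contra ht
      rw [mem_maximalIdeal, mem_nonunits_iff, not_not] at ht
      exact hx ((Submodule.smul_mem_iff_of_isUnit N ht).1 htx)
    rw [← hz ⟨t, ht⟩, LinearMap.comp_apply, ← map_add]
    exact hφ _ h
  · push Not at haN
    obtain ⟨w, hw⟩ := haN
    refine step (a • w) 0 hw fun n t h => ?_
    rw [smul_zero, add_zero]
    refine hφ n ((Submodule.add_mem_iff_left _ ?_).1 h)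
    exact Submodule.smul_mem _ _ (smul_mem_smul_top a w)

/-- If `M/N` is torsion-free and maps `M → C/aC` lift to `C`, then maps `N → C` extend to `M`.
Modulo `a` this is injectivity of `C/aC`, and Nakayama's lemma for `Hom(N, C)` removes `a`. -/
lemma IsDualizing.exists_extend_of_lift [IsNoetherianRing R] [Module.Finite R M]
    (ha : IsParameter a) (hC : IsDualizing a C) (N : Submodule R M)
    (hN : ∀ x : M, a • x ∈ N → x ∈ N)
    (hlift : ∀ ψ : M →ₗ[R] QuotSMulTop a C, ∃ Ψ : M →ₗ[R] C, ∀ x, Submodule.Quotient.mk (Ψ x) = ψ x)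
    (φ : N →ₗ[R] C) : ∃ Φ : M →ₗ[R] C, ∀ n : N, Φ n = φ n := by
  have := hC.finite
  suffices h : (⊤ : Submodule R (N →ₗ[R] C)) ≤ LinearMap.range (LinearMap.lcomp R C N.subtype) by
    obtain ⟨Φ, hΦ⟩ := h (Submodule.mem_top (x := φ))
    exact ⟨Φ, fun n => by rw [← hΦ]; rfl⟩
  refine Submodule.le_of_le_smul_of_le_jacobson_bot (I := maximalIdeal R) Module.Finite.fg_top
    (maximalIdeal_le_jacobson _) fun φ _ => ?_
  obtain ⟨ψ, hψ⟩ := hC.exists_extend_quotient ha N (Submodule.mkQ _ ∘ₗ φ) (fun n hn => by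
    obtain ⟨w, hw⟩ := mem_smul_top_iff.1 hn
    have : n = a • (⟨w, hN w (hw ▸ n.2)⟩ : N) := Subtype.ext hw.symm
    rw [LinearMap.comp_apply, this, map_smul, Submodule.mkQ_apply, Submodule.Quotient.mk_eq_zero]
    exact smul_mem_smul_top _ _)
  obtain ⟨Ψ, hΨ⟩ := hlift ψ
  obtain ⟨χ, hχ⟩ := exists_eq_smul_of_forall_mem hC.regular (φ - Ψ ∘ₗ N.subtype) (fun n => by
    rw [← Submodule.Quotient.mk_eq_zero, LinearMap.sub_apply, Submodule.Quotient.mk_sub,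
      LinearMap.comp_apply, hΨ, Submodule.subtype_apply, hψ]
    exact sub_self _)
  refine Submodule.mem_sup.2 ⟨Ψ ∘ₗ N.subtype, ⟨Ψ, rfl⟩, a • χ,
    Submodule.smul_mem_smul ha.mem Submodule.mem_top, ?_⟩
  ext n
  have := hχ n
  simp only [LinearMap.sub_apply] at this
  simp only [LinearMap.add_apply, LinearMap.smul_apply, ← this]
  abel

lemma IsDualizing.exists_extend_of_projective [IsNoetherianRing R] [Module.Finite R M]
    [Module.Projective R M] (ha : IsParameter a) (hC : IsDualizing a C) (N : Submodule R M)
    (hN : ∀ x : M, a • x ∈ N → x ∈ N) (φ : N →ₗ[R] C) :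
    ∃ Φ : M →ₗ[R] C, ∀ n : N, Φ n = φ n := by
  refine hC.exists_extend_of_lift ha N hN (fun ψ => ?_) φ
  obtain ⟨Ψ, hΨ⟩ := Module.projective_lifting_property
    (Submodule.mkQ (a • (⊤ : Submodule R C))) ψ (Submodule.mkQ_surjective _)
  exact ⟨Ψ, fun x => by rw [← hΨ]; rfl⟩

/-- Maps from a finitely generated torsion-free module `M` to `C/aC` lift to `C`. In terms of a
presentation `0 → N → F → M → 0`, a lift to `F` differs from one that vanishes on `N` by `a` times
a map `N → C`, which extends to `F`. -/
lemma IsDualizing.exists_lift [IsNoetherianRing R] [Module.Finite R M] (ha : IsParameter a)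
    (hC : IsDualizing a C) (hM : IsSMulRegular M a) (ψ : M →ₗ[R] QuotSMulTop a C) :
    ∃ Ψ : M →ₗ[R] C, ∀ x, Submodule.Quotient.mk (Ψ x) = ψ x := by
  obtain ⟨n, p, hp⟩ := Module.Finite.exists_fin' R M
  obtain ⟨Ψ₀, hΨ₀⟩ := Module.projective_lifting_property
    (Submodule.mkQ (a • (⊤ : Submodule R C))) (ψ ∘ₗ p) (Submodule.mkQ_surjective _)
  have hΨ₀' : ∀ x, Submodule.Quotient.mk (Ψ₀ x) = ψ (p x) := fun x => LinearMap.congr_fun hΨ₀ x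
  obtain ⟨χ, hχ⟩ := exists_eq_smul_of_forall_mem hC.regular
    (Ψ₀ ∘ₗ (LinearMap.ker p).subtype) (fun n => by
      rw [← Submodule.Quotient.mk_eq_zero, LinearMap.comp_apply, hΨ₀', Submodule.subtype_apply,
        LinearMap.mem_ker.1 n.2, map_zero])
  obtain ⟨X, hX⟩ := hC.exists_extend_of_projective ha (LinearMap.ker p) (fun x hx => by
    rw [LinearMap.mem_ker, map_smul] at hx
    exact hM.right_eq_zero_of_smul hx) χ
  obtain ⟨Ψ, hΨ⟩ := exists_linearMap_of_surjective_of_ker_le p hp (Ψ₀ - a • X) (fun x hx => by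
    have h1 := hχ ⟨x, hx⟩
    have h2 := hX ⟨x, hx⟩
    simp only [LinearMap.comp_apply, Submodule.subtype_apply] at h1 h2
    simp [h1, h2])
  refine ⟨Ψ, fun m => ?_⟩
  obtain ⟨x, rfl⟩ := hp m
  rw [hΨ, ← hΨ₀', LinearMap.sub_apply, Submodule.Quotient.mk_sub, sub_eq_self,
    Submodule.Quotient.mk_eq_zero]
  exact smul_mem_smul_top _ _

/-- Multiplication by an element outside `aR` is nonzero on `C/aC`: the module `C/aC` is faithful
over `R/a`. Indeed, the map `Rc → C/aC`, `c ↦ σ` extends to `R`, and `c` times the image of `1` is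
the nonzero socle element `σ`. -/
lemma IsDualizing.exists_smul_notMem [IsNoetherianRing R] (ha : IsParameter a)
    (hC : IsDualizing a C) {c : R} (hc : c ∉ a • (⊤ : Submodule R R)) :
    ∃ z : C, c • z ∉ a • (⊤ : Submodule R C) := by
  obtain ⟨σ, hσ, hmσ, -⟩ := hC.socle
  have hunit : ∀ t : R, t * c ∈ a • (⊤ : Submodule R R) → t ∈ maximalIdeal R := by
    intro t ht
    by_contra h
    rw [mem_maximalIdeal, mem_nonunits_iff, not_not] at h
    exact hc ((Submodule.smul_mem_iff_of_isUnit _ h).1 ht)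
  obtain ⟨φ, hφ⟩ := exists_linearMap_range_of_ker_le (LinearMap.toSpanSingleton R R c)
    (LinearMap.toSpanSingleton R (QuotSMulTop a C) (Submodule.Quotient.mk σ)) (fun t ht => by
      rw [LinearMap.mem_ker, LinearMap.toSpanSingleton_apply] at ht ⊢
      rw [← Submodule.Quotient.mk_smul, Submodule.Quotient.mk_eq_zero]
      refine hmσ t (hunit t ?_)
      rw [← smul_eq_mul, ht]
      exact Submodule.zero_mem _)
  obtain ⟨ψ, hψ⟩ := hC.exists_extend_quotient ha _ φ (by
    rintro ⟨-, t, rfl⟩ h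
    rw [hφ, LinearMap.toSpanSingleton_apply, ← Submodule.Quotient.mk_smul,
      Submodule.Quotient.mk_eq_zero]
    exact hmσ t (hunit t h))
  obtain ⟨z, hz⟩ := Submodule.Quotient.mk_surjective _ (ψ 1)
  refine ⟨z, fun h => hσ ?_⟩
  rw [← Submodule.Quotient.mk_eq_zero] at h ⊢
  rw [Submodule.Quotient.mk_smul, hz, ← map_smul, smul_eq_mul, mul_one] at h
  have h1 := hψ ⟨_, 1, rfl⟩
  rw [hφ] at h1
  simpa [h] using h1.symm

/-- Any two canonical modules map onto each other. An isomorphism of socles extends to a map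
`Ψ : C → C'` that is injective modulo `a`; hence `Ψ` is injective with torsion-free cokernel, and
the identity of `C` extends along `Ψ`. -/
lemma IsDualizing.exists_surjective [IsNoetherianRing R] {C' : Type*} [AddCommGroup C']
    [Module R C'] (ha : IsParameter a) (hC : IsDualizing a C) (hC' : IsDualizing a C') :
    ∃ ρ : C' →ₗ[R] C, Function.Surjective ρ := by
  have := hC.finite
  have := hC'.finite
  obtain ⟨σ, hσ, hmσ, hσ'⟩ := hC.socle
  obtain ⟨τ, hτ, hmτ, -⟩ := hC'.socle
  have hunit : ∀ t : R, t • σ ∈ a • (⊤ : Submodule R C) → t ∈ maximalIdeal R := by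
    intro t ht
    by_contra h
    rw [mem_maximalIdeal, mem_nonunits_iff, not_not] at h
    exact hσ ((Submodule.smul_mem_iff_of_isUnit _ h).1 ht)
  obtain ⟨φ, hφ⟩ := exists_linearMap_range_of_ker_le (LinearMap.toSpanSingleton R C σ)
    (LinearMap.toSpanSingleton R (QuotSMulTop a C') (Submodule.Quotient.mk τ)) (fun t ht => by
      rw [LinearMap.mem_ker, LinearMap.toSpanSingleton_apply] at ht ⊢
      rw [← Submodule.Quotient.mk_smul, Submodule.Quotient.mk_eq_zero]
      refine hmτ t (hunit t ?_)
      rw [ht]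
      exact Submodule.zero_mem _)
  obtain ⟨ψ, hψ⟩ := hC'.exists_extend_quotient ha _ φ (by
    rintro ⟨-, t, rfl⟩ h
    rw [hφ, LinearMap.toSpanSingleton_apply, ← Submodule.Quotient.mk_smul,
      Submodule.Quotient.mk_eq_zero]
    exact hmτ t (hunit t h))
  obtain ⟨Ψ, hΨ⟩ := hC'.exists_lift ha hC.regular ψ
  have hΨσ : Ψ σ - τ ∈ a • (⊤ : Submodule R C') := by
    rw [← Submodule.Quotient.mk_eq_zero, Submodule.Quotient.mk_sub, hΨ]
    have h1 := hψ ⟨_, 1, rfl⟩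
    rw [hφ] at h1
    simpa [sub_eq_zero] using h1
  have hmem : ∀ {w : C}, w ∈ a • (⊤ : Submodule R C) → Ψ w ∈ a • (⊤ : Submodule R C') := by
    intro w hw
    obtain ⟨v, rfl⟩ := mem_smul_top_iff.1 hw
    rw [map_smul]
    exact smul_mem_smul_top _ _
  have hinj : ∀ z, Ψ z ∈ a • (⊤ : Submodule R C') → z ∈ a • (⊤ : Submodule R C) := by
    intro z hz
    by_contra hz'
    obtain ⟨t, htz, hmtz⟩ := ha.exists_smul_mem_socle hz'
    obtain ⟨s, hs⟩ := hσ' _ hmtz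
    -- `t z` is congruent to `s σ`, where `s` is a unit because `t z` is nonzero modulo `a`
    have hs' : IsUnit s := by
      by_contra h
      refine htz ?_
      rw [← sub_add_cancel (t • z) (s • σ)]
      exact Submodule.add_mem _ hs (hmσ s h)
    refine hτ ((Submodule.smul_mem_iff_of_isUnit _ hs').1 ?_)
    have h1 := hmem hs
    rw [map_sub, map_smul, map_smul] at h1
    have h2 : s • (Ψ σ - τ) ∈ a • (⊤ : Submodule R C') := Submodule.smul_mem _ _ hΨσ
    have h3 : t • Ψ z ∈ a • (⊤ : Submodule R C') := Submodule.smul_mem _ _ hz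
    have h4 := Submodule.sub_mem _ (Submodule.sub_mem _ h3 h1) h2
    rwa [smul_sub, sub_sub_cancel, sub_sub_cancel] at h4
  have hker : LinearMap.ker Ψ ≤ ⊥ := by
    refine Submodule.le_of_le_smul_of_le_jacobson_bot (I := maximalIdeal R)
      (IsNoetherian.noetherian _) (maximalIdeal_le_jacobson _) fun z hz => ?_
    obtain ⟨w, rfl⟩ := mem_smul_top_iff.1 (hinj z (by
      rw [LinearMap.mem_ker.1 hz]; exact Submodule.zero_mem _))
    rw [LinearMap.mem_ker, map_smul] at hz
    exact Submodule.mem_sup_right (Submodule.smul_mem_smul ha.mem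
      (LinearMap.mem_ker.2 (hC'.regular.right_eq_zero_of_smul hz)))
  obtain ⟨ρ₀, hρ₀⟩ := exists_linearMap_range_of_ker_le Ψ (LinearMap.id : C →ₗ[R] C)
    (hker.trans bot_le)
  obtain ⟨ρ, hρ⟩ := hC.exists_extend_of_lift ha (LinearMap.range Ψ) (fun x hx => by
    obtain ⟨z, hz⟩ := hx
    obtain ⟨w, rfl⟩ := mem_smul_top_iff.1 (hinj z (hz ▸ smul_mem_smul_top _ _))
    rw [map_smul] at hz
    exact ⟨w, hC'.regular hz⟩) (fun ψ => hC.exists_lift ha hC'.regular ψ) ρ₀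
  refine ⟨ρ, fun z => ⟨Ψ z, ?_⟩⟩
  have := hρ ⟨Ψ z, z, rfl⟩
  rw [hρ₀] at this
  simpa using this

end Extension

/-! ### Trace ideals -/

section Trace

variable {R : Type*} [CommRing R] {X Y : Type*} [AddCommGroup X] [Module R X] [AddCommGroup Y]
  [Module R Y]

lemma apply_mem_traceIdeal (f : X →ₗ[R] R) (x : X) : f x ∈ traceIdeal R X :=
  ⟨TensorProduct.tmul R f x, contractLeft_apply f x⟩

lemma traceIdeal_le_iff {I : Ideal R} :
    traceIdeal R X ≤ I ↔ ∀ (f : X →ₗ[R] R) (x : X), f x ∈ I := by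
  refine ⟨fun h f x => h (apply_mem_traceIdeal f x), fun h => ?_⟩
  rintro - ⟨t, rfl⟩
  induction t with
  | zero => simp
  | tmul f x => rw [contractLeft_apply]; exact h f x
  | add s t hs ht => rw [map_add]; exact I.add_mem hs ht

lemma traceIdeal_le_of_surjective (ρ : Y →ₗ[R] X) (hρ : Function.Surjective ρ) :
    traceIdeal R X ≤ traceIdeal R Y :=
  traceIdeal_le_iff.2 fun f x => by
    obtain ⟨y, rfl⟩ := hρ x
    exact apply_mem_traceIdeal (f ∘ₗ ρ) y

end Trace

/-! ### Existence of parameters -/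

section Parameter

variable {R : Type u} [CommRing R] [IsLocalRing R]

lemma IsParameter.of_isSMulRegular [IsNoetherianRing R] (hdim : ringKrullDim R = 1) {a : R}
    (hmem : a ∈ maximalIdeal R) (hreg : IsSMulRegular R a) : IsParameter a := by
  refine ⟨hmem, hreg, ?_⟩
  have h0 : a ∈ nonZeroDivisors R :=
    mem_nonZeroDivisors_iff_right.2 fun x hx =>
      hreg.right_eq_zero_of_smul (by simpa [mul_comm] using hx)
  have h1 := ringKrullDim_quotient_succ_le_of_nonZeroDivisor h0
  rw [hdim] at h1
  have h2 : ringKrullDim (R ⧸ Ideal.span {a}) ≤ 0 := by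
    generalize ringKrullDim (R ⧸ Ideal.span {a}) = d at h1
    induction d with
    | bot => exact bot_le
    | coe d =>
      have h1' : d + 1 ≤ 0 + 1 := by rw [zero_add]; exact_mod_cast h1
      exact_mod_cast (ENat.add_le_add_iff_right ENat.one_ne_top).1 h1'
  have h3 : IsArtinianRing (R ⧸ Ideal.span {a}) :=
    isArtinianRing_iff_krullDimLE_zero.2 (Ring.krullDimLE_iff.2 (by exact_mod_cast h2))
  exact exists_maximalIdeal_pow_le_of_isArtinianRing_quotient _

lemma IsCohenMacaulayLocalRing.exists_isParameter (hR : IsCohenMacaulayLocalRing R)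
    (hdim : ringKrullDim R = 1) : ∃ a : R, IsParameter a := by
  have := hR.noetherian
  obtain ⟨rs, hmem, hreg, hlen⟩ := hR.exists_regular_sequence
  rw [hdim] at hlen
  have hlen' : rs.length = 1 := by exact_mod_cast hlen
  obtain ⟨a, rfl⟩ := List.length_eq_one_iff.1 hlen'
  refine ⟨a, IsParameter.of_isSMulRegular hdim (hmem a (by simp)) ?_⟩
  have := hreg.toIsWeaklyRegular
  rw [RingTheory.Sequence.isWeaklyRegular_cons_iff] at this
  exact this.1

end Parameter

/-! ### `Ext` and short exact sequences with projective middle term -/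

section Ext

open Abelian

variable {R : Type u} [CommRing R] {N F M : Type u} [AddCommGroup N] [Module R N] [AddCommGroup F]
  [Module R F] [AddCommGroup M] [Module R M] (C : Type u) [AddCommGroup C] [Module R C]
  {ι : N →ₗ[R] F} {p : F →ₗ[R] M}

lemma ModuleCat.shortExact_of_exact (hι : Function.Injective ι) (hp : Function.Surjective p)
    (hex : Function.Exact ι p) :
    (ModuleCat.shortComplexOfCompEqZero ι p hex.linearMap_comp_eq_zero).ShortExact :=
  ModuleCat.shortComplex_shortExact _ hex hι hp

variable [Module.Projective R F]

/-- For a short exact sequence `0 → N → F → M → 0` with `F` projective, `Ext¹(M, C)` is the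
cokernel of `Hom(F, C) → Hom(N, C)`. -/
lemma exists_ext_one_presentation (hι : Function.Injective ι) (hp : Function.Surjective p)
    (hex : Function.Exact ι p) :
    ∃ δ : (N →ₗ[R] C) →ₗ[R] Ext.{u} (ModuleCat.of R M) (ModuleCat.of R C) 1,
      Function.Surjective δ ∧ ∀ φ, δ φ = 0 ↔ ∃ Φ : F →ₗ[R] C, Φ ∘ₗ ι = φ := by
  have hS := ModuleCat.shortExact_of_exact hι hp hex
  have : Projective (ModuleCat.shortComplexOfCompEqZero ι p hex.linearMap_comp_eq_zero).X₂ :=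
    inferInstanceAs (Projective (ModuleCat.of R F))
  let e : (N →ₗ[R] C) ≃ₗ[R] Ext.{u} (ModuleCat.of R N) (ModuleCat.of R C) 0 :=
    ((Ext.linearEquiv₀ (R := R)).trans
      (ModuleCat.homLinearEquiv (S := R) (M := ModuleCat.of R N) (N := ModuleCat.of R C))).symm
  have he : ∀ φ, e φ = Ext.mk₀ (ModuleCat.ofHom φ) := fun φ => rfl
  refine ⟨hS.extClass.precompOfLinear R (ModuleCat.of R C) (add_zero 1) ∘ₗ e.toLinearMap,
    (precomp_extClass_surjective_of_projective_X₂ (ModuleCat.of R C) hS 0).comp e.surjective,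
    fun φ => ⟨fun h => ?_, ?_⟩⟩
  · obtain ⟨x, hx⟩ := Ext.contravariant_sequence_exact₁ hS (ModuleCat.of R C) (e φ) (add_zero 1) h
    obtain ⟨Φ, rfl⟩ := (Ext.mk₀_bijective _ _).2 x
    rw [Ext.mk₀_comp_mk₀, he, (Ext.mk₀_bijective _ _).1.eq_iff] at hx
    exact ⟨Φ.hom, by ext n; exact LinearMap.congr_fun (congrArg ModuleCat.Hom.hom hx) n⟩
  · rintro ⟨Φ, rfl⟩
    have : e (Φ ∘ₗ ι) = (Ext.mk₀ (ModuleCat.shortComplexOfCompEqZero ι p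
        hex.linearMap_comp_eq_zero).f).comp (Ext.mk₀ (ModuleCat.ofHom Φ)) (zero_add 0) := by
      rw [Ext.mk₀_comp_mk₀, he]
      rfl
    change hS.extClass.comp (e (Φ ∘ₗ ι)) (add_zero 1) = 0
    rw [this]
    exact hS.extClass_comp_assoc _

/-- Dimension shifting: `Extⁱ⁺²(M, C) ≅ Extⁱ⁺¹(N, C)`. -/
lemma subsingleton_ext_succ_iff (hι : Function.Injective ι) (hp : Function.Surjective p)
    (hex : Function.Exact ι p) (i : ℕ) :
    Subsingleton (Ext.{u} (ModuleCat.of R M) (ModuleCat.of R C) (i + 2)) ↔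
      Subsingleton (Ext.{u} (ModuleCat.of R N) (ModuleCat.of R C) (i + 1)) := by
  have hS := ModuleCat.shortExact_of_exact hι hp hex
  have : Projective (ModuleCat.shortComplexOfCompEqZero ι p hex.linearMap_comp_eq_zero).X₂ :=
    inferInstanceAs (Projective (ModuleCat.of R F))
  have hsurj := precomp_extClass_surjective_of_projective_X₂ (ModuleCat.of R C) hS (i + 1)
  refine ⟨fun h => subsingleton_of_forall_eq 0 fun x => ?_, fun h => ?_⟩
  · obtain ⟨y, rfl⟩ := Ext.contravariant_sequence_exact₁ hS (ModuleCat.of R C) x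
      (n₁ := i + 2) (by omega) (Subsingleton.elim (h := h) _ _)
    rw [Ext.eq_zero_of_projective y, Ext.comp_zero]
  · have := hsurj.subsingleton
    rwa [show i + 2 = i + 1 + 1 from rfl]

end Ext

/-! ### The elementary description agrees with the definition by `Ext` -/

section Canonical

open Abelian

variable {R : Type u} [CommRing R] [IsLocalRing R] {a : R}
  {C : Type u} [AddCommGroup C] [Module R C]

lemma exact_maximalIdeal_residueField : Function.Exact (maximalIdeal R).subtype
    (Algebra.linearMap R (ResidueField R)) := fun x => by
  rw [Submodule.coe_subtype, Subtype.range_coe]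
  exact residue_eq_zero_iff x

/-- A module over a one-dimensional Cohen-Macaulay local ring is torsion-free if and only if it has no
nonzero element annihilated by the maximal ideal, because a power of the maximal ideal is in `aR`. -/
lemma subsingleton_ext_zero_residueField_iff (ha : IsParameter a) :
    Subsingleton (Ext.{u} (ModuleCat.of R (ResidueField R)) (ModuleCat.of R C) 0) ↔
      IsSMulRegular C a := by
  let e : Ext.{u} (ModuleCat.of R (ResidueField R)) (ModuleCat.of R C) 0 ≃
      (ResidueField R →ₗ[R] C) := Ext.homEquiv₀.trans ModuleCat.homEquiv
  rw [e.subsingleton_congr]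
  refine ⟨fun h => ?_, fun h => subsingleton_of_forall_eq 0 fun φ => ?_⟩
  · by_contra hreg
    rw [isSMulRegular_iff_right_eq_zero_of_smul] at hreg
    push Not at hreg
    obtain ⟨z, hz, hz0⟩ := hreg
    let I : Ideal R := LinearMap.ker (LinearMap.toSpanSingleton R C z)
    have hI : I ≠ ⊤ := fun hI => hz0 (by
      have : (1 : R) ∈ I := hI ▸ Submodule.mem_top
      simpa [I] using this)
    obtain ⟨t, ht, hmt⟩ := ha.exists_notMem_forall_smul_mem hI (fun x => by
      simp only [I, LinearMap.mem_ker, LinearMap.toSpanSingleton_apply, smul_eq_mul]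
      rw [mul_comm, mul_smul, hz, smul_zero])
    obtain ⟨φ, hφ⟩ := exists_linearMap_of_surjective_of_ker_le
      (Algebra.linearMap R (ResidueField R)) residue_surjective
      (LinearMap.toSpanSingleton R C (t • z)) (fun y hy => by
        have := hmt y ((residue_eq_zero_iff y).1 hy)
        simpa [I, mul_smul] using this)
    refine ht ?_
    have := hφ 1
    rw [Subsingleton.elim φ 0] at this
    simpa [I] using this.symm
  · refine LinearMap.ext fun x => h.right_eq_zero_of_smul ?_
    rw [← map_smul, Algebra.smul_def,
      show algebraMap R (ResidueField R) a = 0 from (residue_eq_zero_iff a).2 ha.mem,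
      zero_mul, map_zero]

/-- `Ext¹(k, C)` is the quotient of `{z ∈ C | 𝔪 z ⊆ aC}` by `aC`: the element `z` corresponds to the
class of the map `𝔪 → C`, `y ↦ (y z) / a`. -/
lemma exists_ext_one_residueField_presentation (ha : IsParameter a) (hC : IsSMulRegular C a) :
    ∃ δ : (maximalIdeal R →ₗ[R] C) →ₗ[R]
        Ext.{u} (ModuleCat.of R (ResidueField R)) (ModuleCat.of R C) 1,
      Function.Surjective δ ∧
        (∀ φ, δ φ = 0 ↔ φ ⟨a, ha.mem⟩ ∈ a • (⊤ : Submodule R C)) ∧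
        (∀ φ : maximalIdeal R →ₗ[R] C, ∀ y ∈ maximalIdeal R,
          y • φ ⟨a, ha.mem⟩ ∈ a • (⊤ : Submodule R C)) ∧
        ∀ z, (∀ y ∈ maximalIdeal R, y • z ∈ a • (⊤ : Submodule R C)) →
          ∃ φ : maximalIdeal R →ₗ[R] C, φ ⟨a, ha.mem⟩ = z := by
  obtain ⟨δ, hδ, hδ0⟩ := exists_ext_one_presentation C (Submodule.injective_subtype _)
    residue_surjective (exact_maximalIdeal_residueField (R := R))
  have comm : ∀ (φ : maximalIdeal R →ₗ[R] C) (y : maximalIdeal R),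
      (y : R) • φ ⟨a, ha.mem⟩ = a • φ y := fun φ y => by
    rw [← map_smul, ← map_smul]
    congr 1
    exact Subtype.ext (mul_comm _ _)
  refine ⟨δ, hδ, fun φ => ?_, fun φ y hy => comm φ ⟨y, hy⟩ ▸ smul_mem_smul_top _ _, fun z hz => ?_⟩
  · rw [hδ0]
    constructor
    · rintro ⟨Φ, rfl⟩
      refine mem_smul_top_iff.2 ⟨Φ 1, ?_⟩
      rw [← map_smul]
      simp
    · intro h
      obtain ⟨w, hw⟩ := mem_smul_top_iff.1 h
      refine ⟨LinearMap.toSpanSingleton R C w, ?_⟩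
      ext y
      refine hC ?_
      change a • (y : R) • w = a • φ y
      rw [← comm, ← hw, smul_comm]
  · obtain ⟨χ, hχ⟩ := exists_eq_smul_of_forall_mem hC
      (LinearMap.toSpanSingleton R C z ∘ₗ (maximalIdeal R).subtype) (fun y => hz y y.2)
    exact ⟨χ, hC (hχ ⟨a, ha.mem⟩).symm⟩

/-- Over a one-dimensional Cohen-Macaulay local ring with parameter `a`, the canonical modules are
the modules `C` for which `C/aC` is the injective hull of the residue field over `R/a`. -/
theorem IsCanonicalModule.isDualizing (hdim : ringKrullDim R = 1)
    (ha : IsParameter a) (hC : IsCanonicalModule R C) : IsDualizing a C := by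
  have hreg : IsSMulRegular C a := (subsingleton_ext_zero_residueField_iff ha).1
    (hC.ext_eq_zero 0 (by rw [hdim]; decide))
  refine ⟨hC.finite, hreg, ?_, fun φ hφ => ?_⟩
  · obtain ⟨δ, hδ, hδ0, hδ1, hδ2⟩ := exists_ext_one_residueField_presentation ha hreg
    obtain ⟨e⟩ := hC.ext_dim 1 (by rw [hdim]; rfl)
    obtain ⟨φ, hφ⟩ := hδ (e.symm 1)
    refine ⟨φ ⟨a, ha.mem⟩, fun h => ?_, hδ1 φ, fun z hz => ?_⟩
    · rw [← hδ0, hφ] at h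
      simp at h
    · obtain ⟨χ, rfl⟩ := hδ2 z hz
      obtain ⟨t, ht⟩ := residue_surjective (e (δ χ))
      refine ⟨t, ?_⟩
      have : δ (χ - t • φ) = 0 := by
        apply e.injective
        rw [map_sub, map_smul, hφ, map_sub, map_smul, e.apply_symm_apply, ← ht, map_zero,
          Algebra.smul_def, mul_one]
        exact sub_self _
      exact (hδ0 _).1 this
  · -- `Ext¹(𝔪, C) = Ext²(k, C) = 0`, so `φ` lifts to `Ψ : 𝔪 → C`, and `Ψ a = a z` forces `Ψ y = y z`
    have h1 : Subsingleton (Ext.{u} (ModuleCat.of R (maximalIdeal R)) (ModuleCat.of R C) 1) :=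
      (subsingleton_ext_succ_iff C (Submodule.injective_subtype _) residue_surjective
        (exact_maximalIdeal_residueField (R := R)) 0).1
        (hC.ext_eq_zero 2 (by rw [hdim]; decide))
    have hS : (ModuleCat.smulShortComplex (ModuleCat.of R C) a).ShortExact :=
      IsSMulRegular.smulShortComplex_shortExact hreg
    obtain ⟨x, hx⟩ := Ext.covariant_sequence_exact₃ (ModuleCat.of R (maximalIdeal R)) hS
      (Ext.mk₀ (ModuleCat.ofHom φ)) (zero_add 1) (Subsingleton.elim (h := h1) _ _)
    obtain ⟨Φ, rfl⟩ := (Ext.mk₀_bijective _ _).2 x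
    rw [Ext.mk₀_comp_mk₀] at hx
    obtain ⟨Ψ, hΨ⟩ : ∃ Ψ : maximalIdeal R →ₗ[R] C, ∀ y, Submodule.Quotient.mk (Ψ y) = φ y :=
      ⟨Φ.hom, LinearMap.congr_fun (congrArg ModuleCat.Hom.hom ((Ext.mk₀_bijective _ _).1 hx))⟩
    have h0 := hΨ ⟨a, ha.mem⟩
    rw [hφ, Submodule.Quotient.mk_eq_zero] at h0
    obtain ⟨w, hw⟩ := mem_smul_top_iff.1 h0
    refine ⟨Submodule.Quotient.mk w, fun y => ?_⟩
    rw [← hΨ, ← Submodule.Quotient.mk_smul]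
    congr 1
    apply hreg
    change a • Ψ y = a • (y : R) • w
    rw [smul_comm, hw, ← map_smul, ← map_smul]
    congr 1
    exact Subtype.ext (mul_comm _ _)

/-- Positive `Ext`s from finitely generated torsion-free modules into a canonical module vanish. -/
lemma IsDualizing.subsingleton_ext [IsNoetherianRing R] (ha : IsParameter a)
    (hC : IsDualizing a C) (i : ℕ) (M : Type u) [AddCommGroup M] [Module R M] [Module.Finite R M]
    (hM : IsSMulRegular M a) :
    Subsingleton (Ext.{u} (ModuleCat.of R M) (ModuleCat.of R C) (i + 1)) := by
  induction i generalizing M with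
  | zero =>
    obtain ⟨n, p, hp⟩ := Module.Finite.exists_fin' R M
    obtain ⟨δ, hδ, hδ0⟩ := exists_ext_one_presentation C (ι := (LinearMap.ker p).subtype)
      (Submodule.injective_subtype _) hp (LinearMap.exact_subtype_ker_map p)
    refine subsingleton_of_forall_eq 0 fun x => ?_
    obtain ⟨φ, rfl⟩ := hδ x
    obtain ⟨Φ, hΦ⟩ := hC.exists_extend_of_projective ha (LinearMap.ker p) (fun x hx => by
      rw [LinearMap.mem_ker, map_smul] at hx
      exact hM.right_eq_zero_of_smul hx) φ
    exact (hδ0 φ).2 ⟨Φ, LinearMap.ext hΦ⟩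
  | succ i ih =>
    obtain ⟨n, p, hp⟩ := Module.Finite.exists_fin' R M
    refine (subsingleton_ext_succ_iff C (ι := (LinearMap.ker p).subtype)
      (Submodule.injective_subtype _) hp (LinearMap.exact_subtype_ker_map p) i).2 ?_
    refine ih _ fun x y hxy => ?_
    have : IsSMulRegular (Fin n → R) a := IsSMulRegular.pi fun _ => ha.regular
    exact Subtype.ext (this (congrArg Subtype.val hxy))

theorem IsDualizing.isCanonicalModule [IsNoetherianRing R] (hdim : ringKrullDim R = 1)
    (ha : IsParameter a) (hC : IsDualizing a C) : IsCanonicalModule R C := by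
  refine ⟨hC.finite, fun i hi => ?_, fun d hd => ?_⟩
  · rw [hdim] at hi
    match i, hi with
    | 0, _ => exact (subsingleton_ext_zero_residueField_iff ha).2 hC.regular
    | 1, hi => exact absurd rfl hi
    | i + 2, _ =>
      refine (subsingleton_ext_succ_iff C (Submodule.injective_subtype _) residue_surjective
        (exact_maximalIdeal_residueField (R := R)) i).2 ?_
      exact hC.subsingleton_ext ha i _ fun x y hxy =>
        Subtype.ext (ha.regular (congrArg Subtype.val hxy))
  · obtain rfl : d = 1 := by rw [hdim] at hd; exact_mod_cast hd
    obtain ⟨δ, hδ, hδ0, hδ1, hδ2⟩ := exists_ext_one_residueField_presentation ha hC.regular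
    obtain ⟨σ, hσ, hmσ, hσ'⟩ := hC.socle
    obtain ⟨φ, rfl⟩ := hδ2 σ hmσ
    let q := LinearMap.toSpanSingleton R _ (δ φ)
    have hq : ∀ t, q t = 0 ↔ t ∈ maximalIdeal R := fun t => by
      simp only [q, LinearMap.toSpanSingleton_apply]
      rw [← map_smul, hδ0, LinearMap.smul_apply]
      refine ⟨fun h => ?_, fun h => hmσ t h⟩
      by_contra ht
      rw [mem_maximalIdeal, mem_nonunits_iff, not_not] at ht
      exact hσ ((Submodule.smul_mem_iff_of_isUnit _ ht).1 h)
    obtain ⟨e, he⟩ := exists_linearMap_of_surjective_of_ker_le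
      (Algebra.linearMap R (ResidueField R)) residue_surjective q
      (fun t ht => (hq t).2 ((residue_eq_zero_iff t).1 ht))
    refine ⟨(LinearEquiv.ofBijective e ⟨?_, fun x => ?_⟩).symm⟩
    · rw [← LinearMap.ker_eq_bot, LinearMap.ker_eq_bot']
      intro x hx
      obtain ⟨t, rfl⟩ := residue_surjective x
      exact (residue_eq_zero_iff t).2 ((hq t).1 ((he t).symm.trans hx))
    · obtain ⟨χ, rfl⟩ := hδ x
      obtain ⟨t, ht⟩ := hσ' (χ ⟨a, ha.mem⟩) (hδ1 χ)
      refine ⟨algebraMap R _ t, (he t).trans ?_⟩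
      rw [← sub_eq_zero, ← neg_eq_zero, neg_sub]
      have := (hδ0 (χ - t • φ)).2 ht
      rwa [map_sub, map_smul] at this

end Canonical

/-! ### Canonical modules of torsion-free quotients -/

section Quotient

variable {A R : Type*} [CommRing A] [CommRing R] {π : A →+* R}

lemma isNoetherian_of_surjective_algebraMap [Algebra A R] [IsNoetherianRing R]
    (h : Function.Surjective (algebraMap A R)) : IsNoetherian A R := by
  refine ⟨fun N => ?_⟩
  let N' : Submodule R R :=
    { N with
      smul_mem' := fun t x hx => by
        obtain ⟨t, rfl⟩ := h t
        rw [algebraMap_smul]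
        exact N.smul_mem t hx }
  exact Submodule.FG.restrictScalars_of_surjective (S := N') (IsNoetherian.noetherian N') h

/-- The data exhibiting the `R`-module `C` as the submodule `Hom(R, K)` of `K` of all elements
annihilated by the kernel of `π : A → R`. -/
structure IsAnnihilatedPart (π : A →+* R) {K C : Type*} [AddCommGroup K] [Module A K]
    [AddCommGroup C] [Module R C] (ι : C →+ K) : Prop where
  injective : Function.Injective ι
  map_smul : ∀ (x : A) (c : C), ι (π x • c) = x • ι c
  exists_eq : ∀ z : K, (∀ y, π y = 0 → y • z = 0) → ∃ c, ι c = z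

lemma exists_isAnnihilatedPart (hπ : Function.Surjective π) (K : Type u) [AddCommGroup K]
    [Module A K] : ∃ (C : Type u) (_ : AddCommGroup C) (_ : Module R C) (ι : C →+ K),
      IsAnnihilatedPart π ι := by
  let C : Submodule A K :=
    { carrier := {z | ∀ y, π y = 0 → y • z = 0}
      add_mem' := fun hz hw y hy => by rw [smul_add, hz y hy, hw y hy, add_zero]
      zero_mem' := fun y _ => smul_zero y
      smul_mem' := fun x z hz y hy => by rw [smul_comm, hz y hy, smul_zero] }
  let : SMul R C := ⟨fun t z => Function.surjInv hπ t • z⟩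
  have hsmul : ∀ (x : A) (z : C), π x • z = x • z := fun x z => by
    have h : π (Function.surjInv hπ (π x) - x) = 0 := by
      rw [map_sub, Function.surjInv_eq hπ, sub_self]
    have := z.2 _ h
    rw [sub_smul, sub_eq_zero] at this
    exact Subtype.ext this
  let : Module R C := Function.Surjective.moduleLeft π hπ hsmul
  exact ⟨C, inferInstance, inferInstance, C.subtype.toAddMonoidHom, Subtype.val_injective,
    fun x c => congrArg Subtype.val (hsmul x c), fun z hz => ⟨⟨z, hz⟩, rfl⟩⟩

variable {K C : Type*} [AddCommGroup K] [Module A K] [AddCommGroup C] [Module R C] {ι : C →+ K}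
  {a : A}

lemma IsAnnihilatedPart.map_mem_iff (hι : IsAnnihilatedPart π ι) (hreg : IsSMulRegular K a)
    {c : C} : ι c ∈ a • (⊤ : Submodule A K) ↔ c ∈ π a • (⊤ : Submodule R C) := by
  constructor
  · intro h
    obtain ⟨w, hw⟩ := mem_smul_top_iff.1 h
    obtain ⟨d, rfl⟩ := hι.exists_eq w (fun y hy => hreg.right_eq_zero_of_smul (by
      rw [smul_comm, hw, ← hι.map_smul, hy, zero_smul, map_zero]))
    rw [← hι.map_smul] at hw
    exact mem_smul_top_iff.2 ⟨d, hι.injective hw⟩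
  · intro h
    obtain ⟨d, rfl⟩ := mem_smul_top_iff.1 h
    rw [hι.map_smul]
    exact smul_mem_smul_top _ _

variable [IsLocalRing A]

/-- If `R = A/I` is torsion-free and `K` is a canonical module of `A`, then every element of `K/aK`
annihilated by `I` lifts to an element of `K` annihilated by `I`. This says that `Ext¹(R, K) = 0`. -/
lemma IsDualizing.exists_annihilated_sub_mem [IsNoetherianRing A] {a : A} {K : Type*}
    [AddCommGroup K] [Module A K] (ha : IsParameter a) (hK : IsDualizing a K)
    (hreg : IsSMulRegular R (π a)) {z : K}
    (hz : ∀ y, π y = 0 → y • z ∈ a • (⊤ : Submodule A K)) :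
    ∃ c : K, (∀ y, π y = 0 → y • c = 0) ∧ z - c ∈ a • (⊤ : Submodule A K) := by
  obtain ⟨χ, hχ⟩ := exists_eq_smul_of_forall_mem hK.regular
    (LinearMap.toSpanSingleton A K z ∘ₗ (RingHom.ker π).subtype) (fun y => hz y y.2)
  obtain ⟨Φ, hΦ⟩ := hK.exists_extend_of_projective ha (M := A) (RingHom.ker π) (fun x hx => by
    rw [RingHom.mem_ker, smul_eq_mul, map_mul] at hx
    exact hreg.right_eq_zero_of_smul hx) χ
  refine ⟨z - a • Φ 1, fun y hy => ?_, ?_⟩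
  · have h1 := hχ ⟨y, hy⟩
    rw [← hΦ] at h1
    change y • z = a • Φ y at h1
    rw [smul_sub, h1, sub_eq_zero, smul_comm, ← map_smul Φ y, smul_eq_mul, mul_one]
  · rw [sub_sub_cancel]
    exact smul_mem_smul_top _ _

variable [IsLocalRing R]

lemma map_mem_maximalIdeal_iff_of_surjective (hπ : Function.Surjective π) {x : A} :
    π x ∈ maximalIdeal R ↔ x ∈ maximalIdeal A := by
  have : IsLocalHom π := IsLocalHom.of_surjective π hπ
  simp only [mem_maximalIdeal, mem_nonunits_iff, isUnit_map_iff]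

/-- Elements in a high power of the maximal ideal of `A` map to multiples of the parameter `π a`. A
further factor of the maximal ideal puts the quotient into the maximal ideal of `R`. -/
lemma exists_forall_mem_pow_map_eq_mul (hπ : Function.Surjective π) {a : A}
    (ha : IsParameter (π a)) :
    ∃ n, ∀ x ∈ maximalIdeal A ^ n, ∃ y ∈ maximalIdeal R, y * π a = π x := by
  obtain ⟨n, hn⟩ := ha.pow_le
  refine ⟨n + 1, fun x hx => Ideal.mem_mul_span_singleton.1 (Ideal.mul_mono_right hn ?_)⟩
  rw [← pow_succ', ← Ideal.mem_comap]
  refine (Ideal.pow_right_mono (fun y hy => ?_) _).trans (Ideal.le_comap_pow π _) hx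
  exact (map_mem_maximalIdeal_iff_of_surjective hπ).2 hy

/-- If `R` is a torsion-free quotient of `A` and `K` is a canonical module of `A`, then `Hom(R, K)`
is a canonical module of `R`. -/
theorem IsAnnihilatedPart.isDualizing [IsNoetherianRing A] (hπ : Function.Surjective π)
    (hι : IsAnnihilatedPart π ι) (ha : IsParameter a) (hK : IsDualizing a K)
    (hreg : IsSMulRegular R (π a)) : IsDualizing (π a) C := by
  have hmem := fun {c} => hι.map_mem_iff (c := c) hK.regular
  have hlift : ∀ z : K, (∀ y, π y = 0 → y • z ∈ a • (⊤ : Submodule A K)) →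
      ∃ c : C, z - ι c ∈ a • (⊤ : Submodule A K) := fun z hz => by
    obtain ⟨w, hw, hzw⟩ := hK.exists_annihilated_sub_mem ha hreg hz
    obtain ⟨c, rfl⟩ := hι.exists_eq w hw
    exact ⟨c, hzw⟩
  have hker : ∀ y, π y = 0 → y ∈ maximalIdeal A := fun y hy =>
    (map_mem_maximalIdeal_iff_of_surjective hπ).1 (hy ▸ Submodule.zero_mem _)
  refine ⟨?_, fun c d hcd => hι.injective (hK.regular ?_), ?_, fun φ hφ => ?_⟩
  · have := hK.finite
    let := π.toAlgebra
    let := Module.compHom C π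
    have : IsScalarTower A R C := ⟨fun x t c => mul_smul (π x) t c⟩
    have : Module.Finite A C := Module.Finite.of_injective
      ({ toFun := ι, map_add' := map_add ι, map_smul' := hι.map_smul } : C →ₗ[A] K) hι.injective
    exact Module.Finite.of_restrictScalars_finite A R C
  · change a • ι c = a • ι d
    rw [← hι.map_smul, ← hι.map_smul]
    exact congrArg ι hcd
  · obtain ⟨σ, hσ, hmσ, hσ'⟩ := hK.socle
    obtain ⟨s, hs⟩ := hlift σ (fun y hy => hmσ y (hker y hy))
    refine ⟨s, fun h => hσ ?_, fun y hy => ?_, fun z hz => ?_⟩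
    · rw [← sub_add_cancel σ (ι s)]
      exact Submodule.add_mem _ hs (hmem.2 h)
    · obtain ⟨y, rfl⟩ := hπ y
      rw [← hmem, hι.map_smul]
      have h1 := hmσ y ((map_mem_maximalIdeal_iff_of_surjective hπ).1 hy)
      have h2 := Submodule.sub_mem _ h1 (Submodule.smul_mem _ y hs)
      rwa [smul_sub, sub_sub_cancel] at h2
    · obtain ⟨t, ht⟩ := hσ' (ι z) (fun y hy => by
        rw [← hι.map_smul, hmem]
        exact hz _ ((map_mem_maximalIdeal_iff_of_surjective hπ).2 hy))
      refine ⟨π t, ?_⟩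
      rw [← hmem, map_sub, hι.map_smul]
      have h2 := Submodule.add_mem _ ht (Submodule.smul_mem _ t hs)
      rwa [smul_sub, sub_add_sub_cancel] at h2
  · -- compose `φ` with `𝔪_A → 𝔪_R` and `C/aC ↪ K/aK`, using representatives in `C`
    choose c hc using fun y => Submodule.Quotient.mk_surjective _ (φ y)
    let p : maximalIdeal A → maximalIdeal R := fun y =>
      ⟨π y, (map_mem_maximalIdeal_iff_of_surjective hπ).2 y.2⟩
    let φ' : maximalIdeal A →ₗ[A] QuotSMulTop a K :=
      { toFun := fun y => Submodule.Quotient.mk (ι (c (p y)))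
        map_add' := fun x y => by
          rw [← Submodule.Quotient.mk_add, Submodule.Quotient.eq, ← map_add, ← map_sub, hmem,
            ← Submodule.Quotient.mk_eq_zero, Submodule.Quotient.mk_sub, Submodule.Quotient.mk_add,
            hc, hc, hc, ← map_add, sub_eq_zero]
          exact congrArg φ (Subtype.ext (map_add π _ _))
        map_smul' := fun x y => by
          rw [RingHom.id_apply, ← Submodule.Quotient.mk_smul, Submodule.Quotient.eq,
            ← hι.map_smul, ← map_sub, hmem, ← Submodule.Quotient.mk_eq_zero,
            Submodule.Quotient.mk_sub, Submodule.Quotient.mk_smul, hc, hc, ← _root_.map_smul φ,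
            sub_eq_zero]
          exact congrArg φ (Subtype.ext (map_mul π _ _)) }
    obtain ⟨z, hz⟩ := hK.baer φ' (fun h => by
      change Submodule.Quotient.mk (ι (c (p ⟨a, h⟩))) = _
      rw [Submodule.Quotient.mk_eq_zero, hmem, ← Submodule.Quotient.mk_eq_zero, hc]
      exact hφ _)
    obtain ⟨w, rfl⟩ := Submodule.Quotient.mk_surjective _ z
    have hw : ∀ y : maximalIdeal A, ι (c (p y)) - (y : A) • w ∈ a • (⊤ : Submodule A K) :=
      fun y => (Submodule.Quotient.eq _).1 (hz y)
    obtain ⟨d, hd⟩ := hlift w (fun y hy => by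
      have h0 : ι (c (p ⟨y, hker y hy⟩)) ∈ a • (⊤ : Submodule A K) := by
        rw [hmem, ← Submodule.Quotient.mk_eq_zero, hc, ← map_zero φ]
        exact congrArg φ (Subtype.ext hy)
      have h1 := Submodule.sub_mem _ h0 (hw ⟨y, hker y hy⟩)
      rwa [sub_sub_cancel] at h1)
    refine ⟨Submodule.Quotient.mk d, ?_⟩
    rintro ⟨y, hy⟩
    obtain ⟨y, rfl⟩ := hπ y
    have hy' := (map_mem_maximalIdeal_iff_of_surjective hπ).1 hy
    have h1 := Submodule.add_mem _ (hw ⟨y, hy'⟩) (Submodule.smul_mem _ y hd)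
    rw [smul_sub, sub_add_sub_cancel, ← hι.map_smul, ← map_sub, hmem, ← Submodule.Quotient.eq,
      hc] at h1
    exact h1

end Quotient

/-! ### Fiber products over the residue field -/

section FiberProduct

variable {A R S : Type*} [CommRing A] [CommRing R] [IsLocalRing R] [CommRing S]
  [IsLocalRing S] {π₁ : A →+* R} {π₂ : A →+* S}

/-- The local ring `A` is the fiber product of its quotients `R` and `S` over their common residue
field. Equivalently, `A` is a subring of `R × S` that maps onto both factors and contains
`𝔪_R × 𝔪_S`. -/
structure IsFiberProduct (π₁ : A →+* R) (π₂ : A →+* S) : Prop where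
  surjective₁ : Function.Surjective π₁
  surjective₂ : Function.Surjective π₂
  eq_zero : ∀ x, π₁ x = 0 → π₂ x = 0 → x = 0
  exists_left : ∀ y ∈ maximalIdeal R, ∃ j, π₁ j = y ∧ π₂ j = 0
  exists_right : ∀ y ∈ maximalIdeal S, ∃ j, π₁ j = 0 ∧ π₂ j = y

namespace IsFiberProduct

lemma symm (h : IsFiberProduct π₁ π₂) : IsFiberProduct π₂ π₁ where
  surjective₁ := h.surjective₂
  surjective₂ := h.surjective₁
  eq_zero x h₂ h₁ := h.eq_zero x h₁ h₂
  exists_left y hy := (h.exists_right y hy).imp fun _ hj => hj.symm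
  exists_right y hy := (h.exists_left y hy).imp fun _ hj => hj.symm

lemma isNoetherianRing (h : IsFiberProduct π₁ π₂) [IsNoetherianRing R] [IsNoetherianRing S] :
    IsNoetherianRing A := by
  let := π₁.toAlgebra
  let := π₂.toAlgebra
  have : IsNoetherian A R := isNoetherian_of_surjective_algebraMap h.surjective₁
  have : IsNoetherian A S := isNoetherian_of_surjective_algebraMap h.surjective₂
  refine isNoetherian_of_injective
    ((Algebra.linearMap A R).prod (Algebra.linearMap A S)) ?_
  rw [← LinearMap.ker_eq_bot, LinearMap.ker_eq_bot']
  intro x hx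
  exact h.eq_zero x (congrArg Prod.fst hx) (congrArg Prod.snd hx)

variable [IsLocalRing A]

lemma isParameter (h : IsFiberProduct π₁ π₂) {a : A} (h₁ : IsParameter (π₁ a))
    (h₂ : IsParameter (π₂ a)) : IsParameter a := by
  refine ⟨(map_mem_maximalIdeal_iff_of_surjective h.surjective₁).1 h₁.mem, ?_, ?_⟩
  · rw [isSMulRegular_iff_right_eq_zero_of_smul]
    intro x hx
    refine h.eq_zero x (h₁.regular.right_eq_zero_of_smul ?_)
      (h₂.regular.right_eq_zero_of_smul ?_)
    · rw [smul_eq_mul, ← map_mul, ← smul_eq_mul, hx, map_zero]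
    · rw [smul_eq_mul, ← map_mul, ← smul_eq_mul, hx, map_zero]
  · obtain ⟨n₁, hn₁⟩ := exists_forall_mem_pow_map_eq_mul h.surjective₁ h₁
    obtain ⟨n₂, hn₂⟩ := exists_forall_mem_pow_map_eq_mul h.surjective₂ h₂
    refine ⟨n₁ + n₂, fun x hx => ?_⟩
    obtain ⟨y₁, hy₁, hxy₁⟩ := hn₁ x (Ideal.pow_le_pow_right (by omega) hx)
    obtain ⟨y₂, hy₂, hxy₂⟩ := hn₂ x (Ideal.pow_le_pow_right (by omega) hx)
    obtain ⟨j₁, hj₁, hj₁'⟩ := h.exists_left y₁ hy₁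
    obtain ⟨j₂, hj₂, hj₂'⟩ := h.exists_right y₂ hy₂
    refine Ideal.mem_span_singleton'.2 ⟨j₁ + j₂, ?_⟩
    rw [← sub_eq_zero]
    apply h.eq_zero
    · simp [hj₁, hj₂, hxy₁]
    · simp [hj₁', hj₂', hxy₂]

lemma ringKrullDim_eq_one (h : IsFiberProduct π₁ π₂) [IsNoetherianRing A] {a : A}
    (ha : IsParameter a) (hR : ringKrullDim R = 1) : ringKrullDim A = 1 := by
  refine le_antisymm ?_ (hR ▸ ringKrullDim_le_of_surjective π₁ h.surjective₁)
  rw [← maximalIdeal_height_eq_ringKrullDim]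
  have := Ideal.height_le_one_of_isPrincipal_of_mem_minimalPrimes (Ideal.span {a})
    (maximalIdeal A) ⟨⟨inferInstance, (Ideal.span_singleton_le_iff_mem _).2 ha.mem⟩,
      fun q hq _ => by
        obtain ⟨n, hn⟩ := ha.pow_le
        exact hq.1.le_of_pow_le (hn.trans hq.2)⟩
  exact_mod_cast this

end IsFiberProduct

end FiberProduct

/-! ### Discrete valuation rings and multipliers of the maximal ideal -/

section Dichotomy

variable {R : Type*} [CommRing R] [IsLocalRing R] {a : R}

/-- The parameter `a` is adapted to the following dichotomy: either it generates the maximal ideal, and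
the ring is a discrete valuation ring, or there is a fraction `b/a` that is not in `R` and maps the
maximal ideal into itself. -/
def IsAdapted (a : R) : Prop :=
  (∃ b, b ∉ a • (⊤ : Submodule R R) ∧
    ∀ y ∈ maximalIdeal R, ∃ y' ∈ maximalIdeal R, b * y = a * y') ∨
  maximalIdeal R = Ideal.span {a}

/-- Either `R` is a discrete valuation ring, or there is a fraction `b/a ∉ R` that maps the maximal
ideal into itself. Take any `b/a ∉ R` with `(b/a) 𝔪 ⊆ R`: if `(b/a) 𝔪` contains a unit, then `𝔪` is
isomorphic to `R`. -/
lemma IsParameter.exists_isAdapted (ha : IsParameter a) :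
    ∃ r : R, IsParameter r ∧ IsAdapted r := by
  have htop : (a • ⊤ : Submodule R R) ≠ ⊤ := fun h => by
    obtain ⟨w, hw⟩ := mem_smul_top_iff.1 (h.ge Submodule.mem_top : (1 : R) ∈ _)
    exact (mem_maximalIdeal a).1 ha.mem (IsUnit.of_mul_eq_one w hw)
  obtain ⟨b, hb, hmb⟩ := ha.exists_notMem_forall_smul_mem htop (fun x => smul_mem_smul_top a x)
  have hmb' : ∀ y ∈ maximalIdeal R, ∃ y', b * y = a * y' := fun y hy => by
    obtain ⟨w, hw⟩ := mem_smul_top_iff.1 (hmb y hy)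
    exact ⟨w, by rw [mul_comm b]; exact hw.symm⟩
  by_cases h : ∀ y ∈ maximalIdeal R, ∃ y' ∈ maximalIdeal R, b * y = a * y'
  · exact ⟨a, ha, Or.inl ⟨b, hb, h⟩⟩
  · push Not at h
    obtain ⟨y, hy, hy'⟩ := h
    obtain ⟨w, hw⟩ := hmb' y hy
    have hwu : IsUnit w := by
      by_contra hwu
      exact hy' w ((mem_maximalIdeal w).2 hwu) hw
    obtain ⟨w, rfl⟩ := hwu
    -- `b y` is associated to `a`, hence regular, and `b x = a x'` is a multiple of `b y`
    have hby : IsSMulRegular R (b * y) := by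
      rw [hw]
      exact ha.regular.mul (IsSMulRegular.of_mul_eq_one (a := (↑w⁻¹ : R)) (by simp))
    have hb' : IsSMulRegular R b := IsSMulRegular.of_mul (a := y) (by rwa [mul_comm])
    have hspan : maximalIdeal R = Ideal.span {y} := by
      refine le_antisymm (fun x hx => ?_) ((Ideal.span_singleton_le_iff_mem _).2 hy)
      obtain ⟨x', hx'⟩ := hmb' x hx
      refine Ideal.mem_span_singleton'.2 ⟨x' * ↑w⁻¹, hb' ?_⟩
      change b * (x' * ↑w⁻¹ * y) = b * x
      calc b * (x' * ↑w⁻¹ * y) = b * y * (x' * ↑w⁻¹) := by ring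
        _ = a * x' * (w * ↑w⁻¹) := by rw [hw]; ring
        _ = b * x := by rw [Units.mul_inv, mul_one, hx']
    exact ⟨y, ⟨hy, IsSMulRegular.of_mul hby, 1, by rw [pow_one, hspan]⟩, Or.inr hspan⟩

variable {C : Type*} [AddCommGroup C] [Module R C]

/-- Any nonzero element of the simple socle of `C/aC` generates it. -/
lemma IsDualizing.exists_sub_smul_mem (hC : IsDualizing a C) {v w : C}
    (hv : v ∉ a • (⊤ : Submodule R C))
    (hmv : ∀ y ∈ maximalIdeal R, y • v ∈ a • (⊤ : Submodule R C))
    (hmw : ∀ y ∈ maximalIdeal R, y • w ∈ a • (⊤ : Submodule R C)) :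
    ∃ t : R, w - t • v ∈ a • (⊤ : Submodule R C) := by
  obtain ⟨σ, -, hmσ, hσ⟩ := hC.socle
  obtain ⟨s, hs⟩ := hσ v hmv
  obtain ⟨t, ht⟩ := hσ w hmw
  have hsu : IsUnit s := by
    by_contra h
    exact hv ((Submodule.sub_mem_iff_left _ (hmσ s h)).1 hs)
  obtain ⟨s, rfl⟩ := hsu
  refine ⟨t * ↑s⁻¹, ?_⟩
  have h1 := Submodule.sub_mem _ ht (Submodule.smul_mem _ (t * ↑s⁻¹ : R) hs)
  rwa [smul_sub, smul_smul, mul_assoc, Units.inv_mul, mul_one, sub_sub_sub_cancel_right] at h1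

/-- If the maximal ideal is generated by `a`, then a canonical module is free of rank one, generated
by any element outside `aC`. -/
lemma IsDualizing.exists_apply_eq_one [IsNoetherianRing R] (ha : IsParameter a)
    (hC : IsDualizing a C) (hm : maximalIdeal R = Ideal.span {a}) {v : C}
    (hv : v ∉ a • (⊤ : Submodule R C)) : ∃ ψ : C →ₗ[R] R, ψ v = 1 := by
  have := hC.finite
  have hmC : ∀ z : C, ∀ y ∈ maximalIdeal R, y • z ∈ a • (⊤ : Submodule R C) := fun z y hy => by
    rw [hm] at hy
    obtain ⟨t, rfl⟩ := Ideal.mem_span_singleton'.1 hy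
    rw [mul_comm, mul_smul]
    exact smul_mem_smul_top _ _
  let p := LinearMap.toSpanSingleton R C v
  have hsurj : (⊤ : Submodule R C) ≤ LinearMap.range p := by
    refine Submodule.le_of_le_smul_of_le_jacobson_bot (I := maximalIdeal R) Module.Finite.fg_top
      (maximalIdeal_le_jacobson _) fun z _ => ?_
    obtain ⟨t, ht⟩ := hC.exists_sub_smul_mem hv (hmC v) (hmC z)
    obtain ⟨w, hw⟩ := mem_smul_top_iff.1 ht
    exact Submodule.mem_sup.2 ⟨t • v, ⟨t, rfl⟩, a • w,
      Submodule.smul_mem_smul ha.mem Submodule.mem_top, by rw [hw, add_sub_cancel]⟩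
  have hinj : LinearMap.ker p ≤ ⊥ := by
    refine Submodule.le_of_le_smul_of_le_jacobson_bot (I := maximalIdeal R)
      (IsNoetherian.noetherian _) (maximalIdeal_le_jacobson _) fun t ht => ?_
    have ht0 : t • v = 0 := ht
    have htm : t ∈ maximalIdeal R := by
      by_contra h
      rw [mem_maximalIdeal, mem_nonunits_iff, not_not] at h
      refine hv ((Submodule.smul_mem_iff_of_isUnit _ h).1 ?_)
      rw [ht0]
      exact Submodule.zero_mem _
    rw [hm] at htm
    obtain ⟨t, rfl⟩ := Ideal.mem_span_singleton'.1 htm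
    rw [mul_comm, mul_smul] at ht0
    refine Submodule.mem_sup_right ?_
    rw [mul_comm]
    exact Submodule.smul_mem_smul ha.mem (hC.regular.right_eq_zero_of_smul ht0)
  obtain ⟨ψ, hψ⟩ := exists_linearMap_of_surjective_of_ker_le p
    (LinearMap.range_eq_top.1 (top_le_iff.1 hsurj)) LinearMap.id (hinj.trans bot_le)
  exact ⟨ψ, by simpa [p] using hψ 1⟩

/-- If `(b/a) 𝔪 ⊆ 𝔪` and `b/a ∉ R`, then the elements of `C` that represent socle elements of `C/aC`
are in `aC + R b z` for a fixed `z`. Such a `z` exists because `C/aC` is faithful over `R/a`. -/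
lemma IsDualizing.exists_eq_add_smul_of_multiplier [IsNoetherianRing R] {b : R}
    (ha : IsParameter a) (hC : IsDualizing a C) (hb : b ∉ a • (⊤ : Submodule R R))
    (hmb : ∀ y ∈ maximalIdeal R, ∃ y' ∈ maximalIdeal R, b * y = a * y') :
    ∃ z : C, ∀ w, (∀ y ∈ maximalIdeal R, y • w ∈ a • (⊤ : Submodule R C)) →
      ∃ (κ : C) (t : R), w = a • κ + t • b • z := by
  obtain ⟨z, hz⟩ := hC.exists_smul_notMem ha hb
  refine ⟨z, fun w hw => ?_⟩
  obtain ⟨t, ht⟩ := hC.exists_sub_smul_mem hz (fun y hy => by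
    obtain ⟨y', -, hy'⟩ := hmb y hy
    rw [smul_smul, mul_comm, hy', mul_smul]
    exact smul_mem_smul_top _ _) hw
  obtain ⟨κ, hκ⟩ := mem_smul_top_iff.1 ht
  exact ⟨κ, t, by rw [hκ, sub_add_cancel]⟩

end Dichotomy

/-! ### Comparing the traces of the canonical modules -/

section FiberProduct

variable {A R S : Type*} [CommRing A] [CommRing R] [IsLocalRing R] [CommRing S]
  [IsLocalRing S] {π₁ : A →+* R} {π₂ : A →+* S}
  {K C : Type*} [AddCommGroup K] [Module A K] [AddCommGroup C] [Module R C] {ι : C →+ K} {a : A}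

namespace IsFiberProduct

lemma exists_parameter (h : IsFiberProduct π₁ π₂) (hR : IsCohenMacaulayLocalRing R)
    (hS : IsCohenMacaulayLocalRing S) (hdimR : ringKrullDim R = 1) (hdimS : ringKrullDim S = 1) :
    ∃ a : A, (IsParameter (π₁ a) ∧ IsAdapted (π₁ a)) ∧ IsParameter (π₂ a) ∧ IsAdapted (π₂ a) := by
  obtain ⟨r₀, hr₀⟩ := hR.exists_isParameter hdimR
  obtain ⟨s₀, hs₀⟩ := hS.exists_isParameter hdimS
  obtain ⟨r, hr⟩ := hr₀.exists_isAdapted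
  obtain ⟨s, hs⟩ := hs₀.exists_isAdapted
  obtain ⟨x, hx₁, hx₂⟩ := h.exists_left r hr.1.mem
  obtain ⟨y, hy₁, hy₂⟩ := h.exists_right s hs.1.mem
  refine ⟨x + y, ?_⟩
  rw [map_add, map_add, hx₁, hx₂, hy₁, hy₂, add_zero, zero_add]
  exact ⟨hr, hs⟩

/-- A semilinear map from `K` to the maximal ideal of `R` is a linear map to `𝔪_R × 0 ⊆ A`. -/
lemma exists_linearMap_of_semilinear (h : IsFiberProduct π₁ π₂) (θ : K →ₛₗ[π₁] R)
    (hθ : ∀ w, θ w ∈ maximalIdeal R) :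
    ∃ f : K →ₗ[A] A, ∀ w, π₁ (f w) = θ w ∧ π₂ (f w) = 0 := by
  choose f hf₁ hf₂ using fun w => h.exists_left _ (hθ w)
  refine ⟨⟨⟨f, fun x y => ?_⟩, fun x y => ?_⟩, fun w => ⟨hf₁ w, hf₂ w⟩⟩
  · rw [← sub_eq_zero]
    apply h.eq_zero
    · simp [hf₁]
    · simp [hf₂]
  · rw [← sub_eq_zero]
    apply h.eq_zero
    · simp [hf₁]
    · simp [hf₂]

variable [IsLocalRing A]

/-- Multiplication by `e = (r, 0)`, where `a = (r, s)`, is a map `g` from `K` to `C = Hom(R, K)`. It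
restricts to multiplication by `r` on `C`, and its image is in the preimage of the socle of `C/rC`.
It is not contained in `rC` because otherwise `K` would be the direct sum of `Hom(R, K)` and
`Hom(S, K)`, and the socle of `K/aK` would not be simple. -/
lemma exists_toAnnihilatedPart [IsNoetherianRing A] (h : IsFiberProduct π₁ π₂)
    (hι : IsAnnihilatedPart π₁ ι) (ha : IsParameter a) (h₁ : IsParameter (π₁ a))
    (h₂ : IsParameter (π₂ a)) (hK : IsDualizing a K) :
    ∃ (e : A) (g : K →ₛₗ[π₁] C), π₁ e = π₁ a ∧ (∀ w, ι (g w) = e • w) ∧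
      (∀ c, g (ι c) = π₁ a • c) ∧
      (∀ w, ∀ y ∈ maximalIdeal R, y • g w ∈ π₁ a • (⊤ : Submodule R C)) ∧
      ∃ w, g w ∉ π₁ a • (⊤ : Submodule R C) := by
  obtain ⟨e, he₁, he₂⟩ := h.exists_left _ h₁.mem
  have hann : ∀ j, π₂ j = 0 → ∀ w : K, ∃ c, ι c = j • w := fun j hj w =>
    hι.exists_eq _ fun y hy => by
      rw [smul_smul, h.eq_zero (y * j) (by rw [map_mul, hy, zero_mul])
        (by rw [map_mul, hj, mul_zero]), zero_smul]
  choose g hg using hann e he₂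
  have hgι : ∀ c, g (ι c) = π₁ a • c := fun c => hι.injective (by
    rw [hg, ← hι.map_smul, he₁])
  refine ⟨e, ⟨⟨g, fun x y => hι.injective ?_⟩, fun x y => hι.injective ?_⟩, he₁, hg, hgι,
    fun w y hy => ?_, ?_⟩
  · rw [map_add, hg, hg, hg, smul_add]
  · change ι (g (x • y)) = ι (π₁ x • g y)
    rw [hι.map_smul, hg, hg, smul_comm]
  · obtain ⟨j, rfl, hj⟩ := h.exists_left y hy
    obtain ⟨c, hc⟩ := hann j hj w
    refine mem_smul_top_iff.2 ⟨c, hι.injective ?_⟩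
    change _ = ι (π₁ j • g w)
    rw [hι.map_smul, hι.map_smul, hg, smul_comm j, ← hc, ← hι.map_smul, ← hι.map_smul, he₁]
  · by_contra! hsplit
    obtain ⟨σ, hσ, hmσ, -⟩ := hK.socle
    have hker₁ : ∀ y, π₁ y = 0 → y ∈ maximalIdeal A := fun y hy =>
      (map_mem_maximalIdeal_iff_of_surjective h.surjective₁).1 (hy ▸ Submodule.zero_mem _)
    have hker₂ : ∀ y, π₂ y = 0 → y ∈ maximalIdeal A := fun y hy =>
      (map_mem_maximalIdeal_iff_of_surjective h.surjective₂).1 (hy ▸ Submodule.zero_mem _)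
    obtain ⟨c', hc', hcσ⟩ := hK.exists_annihilated_sub_mem ha h₁.regular (z := σ)
      (fun y hy => hmσ y (hker₁ y hy))
    obtain ⟨c, rfl⟩ := hι.exists_eq c' hc'
    obtain ⟨d, hd, hdσ⟩ := hK.exists_annihilated_sub_mem ha h₂.regular (z := σ)
      (fun y hy => hmσ y (hker₂ y hy))
    have hcd := Submodule.sub_mem _ hdσ hcσ
    rw [sub_sub_sub_cancel_left] at hcd
    obtain ⟨w, hw⟩ := mem_smul_top_iff.1 hcd
    -- multiplying `c - d = a w` by `e` gives `c = e w`, which is in `aC` by assumption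
    have hcw : c = g w := by
      apply hι.injective
      apply hK.regular
      change a • ι c = a • ι (g w)
      rw [hg, smul_comm, hw, smul_sub, hd e he₂, sub_zero, ← hι.map_smul, ← hι.map_smul, he₁]
    refine hσ ((Submodule.sub_mem_iff_left _ ?_).1 hcσ)
    rw [hι.map_mem_iff hK.regular, hcw]
    exact hsplit w

/-- A linear map `K → A` maps `Hom(R, K)` into `𝔪_R × 0`, the annihilator of `0 × 𝔪_S` in `A`. -/
lemma map_apply_mem_maximalIdeal (h : IsFiberProduct π₁ π₂) (hι : IsAnnihilatedPart π₁ ι)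
    (h₂ : IsParameter (π₂ a)) (f : K →ₗ[A] A) (c : C) : π₁ (f (ι c)) ∈ maximalIdeal R := by
  obtain ⟨y, hy₁, hy₂⟩ := h.exists_right _ h₂.mem
  have h1 : y • f (ι c) = 0 := by
    rw [← map_smul, ← hι.map_smul, hy₁, zero_smul, map_zero, map_zero]
  have h2 : π₂ (f (ι c)) = 0 := h₂.regular.right_eq_zero_of_smul (by
    rw [smul_eq_mul, ← hy₂, ← map_mul, ← smul_eq_mul, h1, map_zero])
  rw [map_mem_maximalIdeal_iff_of_surjective h.surjective₁,
    ← map_mem_maximalIdeal_iff_of_surjective h.surjective₂, h2]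
  exact Submodule.zero_mem _

/-- The trace of `K` maps into the trace of `C = Hom(R, K)`. If `R` is not a discrete valuation
ring, this is because `K → R` is determined by its restriction `Θ : C → 𝔪_R`: its values are
combinations of values of `Θ` and of `(b/r) Θ`. -/
theorem traceIdeal_le_comap [IsNoetherianRing A] [IsNoetherianRing R] (h : IsFiberProduct π₁ π₂)
    (hι : IsAnnihilatedPart π₁ ι) (ha : IsParameter a) (h₁ : IsParameter (π₁ a))
    (h₂ : IsParameter (π₂ a)) (hK : IsDualizing a K)
    (hR : IsAdapted (π₁ a)) :
    traceIdeal A K ≤ (traceIdeal R C).comap π₁ := by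
  have hC := hι.isDualizing h.surjective₁ ha hK h₁.regular
  obtain ⟨e, g, he, hιg, -, hmg, v, hv⟩ := h.exists_toAnnihilatedPart hι ha h₁ h₂ hK
  refine traceIdeal_le_iff.2 fun f w => ?_
  rw [Ideal.mem_comap]
  obtain ⟨b, hb, hmb⟩ | hm := hR
  · let Θ : C →ₗ[R] R :=
      { toFun := fun c => π₁ (f (ι c))
        map_add' := fun c d => by simp only [map_add]
        map_smul' := fun t c => by
          obtain ⟨t, rfl⟩ := h.surjective₁ t
          rw [hι.map_smul, map_smul, smul_eq_mul, map_mul]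
          rfl }
    have hΘ : ∀ c, Θ c ∈ maximalIdeal R := h.map_apply_mem_maximalIdeal hι h₂ f
    obtain ⟨ψ, hψ⟩ := exists_eq_smul_of_forall_mem h₁.regular (b • Θ) (fun c => by
      obtain ⟨y', -, hy'⟩ := hmb _ (hΘ c)
      exact mem_smul_top_iff.2 ⟨y', hy'.symm⟩)
    obtain ⟨z, hz⟩ := hC.exists_eq_add_smul_of_multiplier h₁ hb hmb
    obtain ⟨κ, t, hκ⟩ := hz _ (hmg w)
    have key : π₁ (f w) = Θ κ + t * ψ z := by
      apply h₁.regular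
      change π₁ a * π₁ (f w) = π₁ a * (Θ κ + t * ψ z)
      have h3 : b * Θ z = π₁ a * ψ z := hψ z
      calc π₁ a * π₁ (f w) = π₁ (f (e • w)) := by rw [map_smul, smul_eq_mul, map_mul, he]
        _ = Θ (g w) := by rw [← hιg]; rfl
        _ = π₁ a * Θ κ + t * (b * Θ z) := by
          rw [hκ, map_add, map_smul, map_smul, map_smul]; rfl
        _ = _ := by rw [h3]; ring
    rw [key]
    exact Ideal.add_mem _ (apply_mem_traceIdeal Θ κ)
      (Ideal.mul_mem_left _ _ (apply_mem_traceIdeal ψ z))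
  · obtain ⟨ψ, hψ⟩ := hC.exists_apply_eq_one h₁ hm hv
    have h1 : (1 : R) ∈ traceIdeal R C := hψ ▸ apply_mem_traceIdeal ψ (g v)
    rw [(Ideal.eq_top_iff_one _).2 h1]
    exact Submodule.mem_top

/-- If the trace of `C = Hom(R, K)` contains the maximal ideal of `R`, then the trace of `K` contains
`𝔪_R × 0`. If `R` is not a discrete valuation ring, this is because maps `C → 𝔪_R` extend to `K`. -/
theorem mem_traceIdeal [IsNoetherianRing A] [IsNoetherianRing R] (h : IsFiberProduct π₁ π₂)
    (hι : IsAnnihilatedPart π₁ ι) (ha : IsParameter a) (h₁ : IsParameter (π₁ a))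
    (h₂ : IsParameter (π₂ a)) (hK : IsDualizing a K)
    (hR : IsAdapted (π₁ a))
    (htr : maximalIdeal R ≤ traceIdeal R C) {j : A} (hj : π₂ j = 0) : j ∈ traceIdeal A K := by
  have hC := hι.isDualizing h.surjective₁ ha hK h₁.regular
  obtain ⟨e, g, -, -, hgι, hmg, v, hv⟩ := h.exists_toAnnihilatedPart hι ha h₁ h₂ hK
  let T : Ideal R := (traceIdeal A K ⊓ RingHom.ker π₂).map π₁
  have hT : ∀ θ : K →ₛₗ[π₁] R, (∀ w, θ w ∈ maximalIdeal R) → ∀ w, θ w ∈ T := fun θ hθ w => by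
    obtain ⟨f, hf⟩ := h.exists_linearMap_of_semilinear θ hθ
    rw [← (hf w).1]
    exact Ideal.mem_map_of_mem _ ⟨apply_mem_traceIdeal f w, (hf w).2⟩
  suffices hmT : maximalIdeal R ≤ T by
    have hj₁ : π₁ j ∈ maximalIdeal R := by
      rw [map_mem_maximalIdeal_iff_of_surjective h.surjective₁,
        ← map_mem_maximalIdeal_iff_of_surjective h.surjective₂, hj]
      exact Submodule.zero_mem _
    obtain ⟨j', ⟨hj', hj'₂⟩, hjj'⟩ := (Ideal.mem_map_iff_of_surjective π₁ h.surjective₁).1 (hmT hj₁)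
    have : j' - j = 0 := h.eq_zero _ (by rw [map_sub, hjj', sub_self])
      (by rw [map_sub, hj, (RingHom.mem_ker).1 hj'₂, sub_zero])
    rwa [← sub_eq_zero.1 this]
  obtain ⟨b, hb, hmb⟩ | hm := hR
  · obtain ⟨z, hz⟩ := hC.exists_eq_add_smul_of_multiplier h₁ hb hmb
    -- a map `ψ : C → 𝔪` extends to `K` as `ψ ∘ g` divided by `r`
    have hψT : ∀ ψ : C →ₗ[R] R, (∀ c, ψ c ∈ maximalIdeal R) → ∀ c, ψ c ∈ T := by
      intro ψ hψ c
      have hex : ∀ w, ∃ y ∈ maximalIdeal R, ψ (g w) = π₁ a * y := fun w => by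
        obtain ⟨κ, t, hκ⟩ := hz _ (hmg w)
        obtain ⟨y', hy', hby'⟩ := hmb _ (hψ z)
        refine ⟨ψ κ + t * y', Ideal.add_mem _ (hψ κ) (Ideal.mul_mem_left _ _ hy'), ?_⟩
        rw [hκ, map_add, map_smul, map_smul, map_smul, smul_eq_mul, smul_eq_mul, smul_eq_mul, hby']
        ring
      choose θ hθ hψθ using hex
      let θ' : K →ₛₗ[π₁] R :=
        { toFun := θ
          map_add' := fun x y => h₁.regular (by
            change π₁ a * θ (x + y) = π₁ a * (θ x + θ y)
            rw [mul_add, ← hψθ, ← hψθ, ← hψθ, map_add, map_add])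
          map_smul' := fun x y => h₁.regular (by
            change π₁ a * θ (x • y) = π₁ a * (π₁ x * θ y)
            rw [← hψθ, mul_left_comm, ← hψθ, LinearMap.map_smulₛₗ, map_smul, smul_eq_mul]) }
      have h1 : θ (ι c) = ψ c := h₁.regular (by
        change π₁ a * θ (ι c) = π₁ a * ψ c
        rw [← hψθ, hgι, map_smul, smul_eq_mul])
      exact h1 ▸ hT θ' hθ (ι c)
    by_cases hunit : ∃ (ψ : C →ₗ[R] R) (c : C), IsUnit (ψ c)
    · obtain ⟨ψ, c, u, hu⟩ := hunit
      intro y hy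
      have h1 := hψT (y • ψ) (fun c => Ideal.mul_mem_right _ _ hy) c
      have h2 := Ideal.mul_mem_right (↑u⁻¹ : R) _ h1
      rwa [LinearMap.smul_apply, ← hu, smul_eq_mul, mul_assoc, Units.mul_inv, mul_one] at h2
    · push Not at hunit
      exact htr.trans (traceIdeal_le_iff.2 fun ψ c => hψT ψ (fun c => hunit ψ c) c)
  · obtain ⟨ψ, hψ⟩ := hC.exists_apply_eq_one h₁ hm hv
    have h1 := hT ((π₁ a • ψ).comp g) (fun w => Ideal.mul_mem_right _ _ h₁.mem) v
    rw [LinearMap.comp_apply, LinearMap.smul_apply, hψ, smul_eq_mul, mul_one] at h1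
    rw [hm]
    exact (Ideal.span_singleton_le_iff_mem _).2 h1

end IsFiberProduct

end FiberProduct

/-! ### Nearly Gorenstein fiber products -/

section NearlyGorenstein

variable {A R S : Type u} [CommRing A] [IsLocalRing A] [CommRing R] [IsLocalRing R] [CommRing S]
  [IsLocalRing S] {π₁ : A →+* R} {π₂ : A →+* S}

namespace IsFiberProduct

theorem isNearlyGorenstein_left (h : IsFiberProduct π₁ π₂)
    (hR : IsCohenMacaulayLocalRing R) (hS : IsCohenMacaulayLocalRing S)
    (hdimR : ringKrullDim R = 1) (hdimS : ringKrullDim S = 1) (hA : IsNearlyGorenstein A) :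
    IsNearlyGorenstein R := by
  have := hR.noetherian
  have := hS.noetherian
  have := h.isNoetherianRing
  obtain ⟨a, ⟨h₁, h₁'⟩, h₂, -⟩ := h.exists_parameter hR hS hdimR hdimS
  have ha := h.isParameter h₁ h₂
  obtain ⟨K, _, _, hK, htr⟩ := hA
  have hK' := hK.isDualizing (h.ringKrullDim_eq_one ha hdimR) ha
  obtain ⟨C, _, _, ι, hι⟩ := exists_isAnnihilatedPart h.surjective₁ K
  refine ⟨C, _, _, (hι.isDualizing h.surjective₁ ha hK' h₁.regular).isCanonicalModule hdimR h₁,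
    fun y hy => ?_⟩
  obtain ⟨x, rfl⟩ := h.surjective₁ y
  exact h.traceIdeal_le_comap hι ha h₁ h₂ hK' h₁'
    (htr ((map_mem_maximalIdeal_iff_of_surjective h.surjective₁).1 hy))

/-- If `R` is nearly Gorenstein, then the trace of the canonical module of `A` contains `𝔪_R × 0`. By
uniqueness of canonical modules, the trace of `Hom(R, K)` is that of the given canonical module. -/
theorem ker_le_traceIdeal (h : IsFiberProduct π₁ π₂) [IsNoetherianRing A] [IsNoetherianRing R]
    {a : A} (ha : IsParameter a) (h₁ : IsParameter (π₁ a)) (h₁' : IsAdapted (π₁ a))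
    (h₂ : IsParameter (π₂ a)) (hdimR : ringKrullDim R = 1) {K : Type u} [AddCommGroup K]
    [Module A K] (hK : IsDualizing a K) (hR : IsNearlyGorenstein R) :
    RingHom.ker π₂ ≤ traceIdeal A K := by
  obtain ⟨C, _, _, ι, hι⟩ := exists_isAnnihilatedPart h.surjective₁ K
  have hC := hι.isDualizing h.surjective₁ ha hK h₁.regular
  obtain ⟨K₁, _, _, hK₁, htr⟩ := hR
  obtain ⟨ρ, hρ⟩ := (hK₁.isDualizing hdimR h₁).exists_surjective h₁ hC
  exact fun j hj => h.mem_traceIdeal hι ha h₁ h₂ hK h₁'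
    (htr.trans (traceIdeal_le_of_surjective ρ hρ)) hj

theorem isNearlyGorenstein_iff (h : IsFiberProduct π₁ π₂)
    (hR : IsCohenMacaulayLocalRing R) (hS : IsCohenMacaulayLocalRing S)
    (hdimR : ringKrullDim R = 1) (hdimS : ringKrullDim S = 1) (hA : HasCanonicalModule A) :
    IsNearlyGorenstein A ↔ IsNearlyGorenstein R ∧ IsNearlyGorenstein S := by
  refine ⟨fun hN => ⟨h.isNearlyGorenstein_left hR hS hdimR hdimS hN,
    h.symm.isNearlyGorenstein_left hS hR hdimS hdimR hN⟩, fun ⟨hNR, hNS⟩ => ?_⟩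
  have := hR.noetherian
  have := hS.noetherian
  have := h.isNoetherianRing
  obtain ⟨a, ⟨h₁, h₁'⟩, h₂, h₂'⟩ := h.exists_parameter hR hS hdimR hdimS
  have ha := h.isParameter h₁ h₂
  obtain ⟨K, _, _, hK⟩ := hA
  have hK' := hK.isDualizing (h.ringKrullDim_eq_one ha hdimR) ha
  refine ⟨K, _, _, hK, fun x hx => ?_⟩
  obtain ⟨j, hj₁, hj₂⟩ := h.exists_left (π₁ x)
    ((map_mem_maximalIdeal_iff_of_surjective h.surjective₁).2 hx)
  rw [← add_sub_cancel j x]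
  refine Ideal.add_mem _ (h.ker_le_traceIdeal ha h₁ h₁' h₂ hdimR hK' hNR hj₂)
    (h.symm.ker_le_traceIdeal ha h₂ h₂' h₁ hdimS hK' hNS ?_)
  rw [RingHom.mem_ker, map_sub, hj₁, sub_self]

end IsFiberProduct

lemma map_eq_zero_of_mem_maximalIdeal {R : Type*} {k : Type*} [CommRing R] [IsLocalRing R] [Field k]
    (f : R →+* k) [RingHomSurjective f] {y : R} (hy : y ∈ maximalIdeal R) : f y = 0 := by
  have : IsLocalHom f := IsLocalHom.of_surjective f f.surjective
  by_contra h
  exact (mem_maximalIdeal y).1 hy (isUnit_of_map_unit f y (isUnit_iff_ne_zero.2 h))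

lemma isFiberProduct_pullback {R S : Type u} {k : Type v} [CommRing R] [IsLocalRing R]
    [CommRing S] [IsLocalRing S] [Field k] (f : R →+* k) (g : S →+* k) [RingHomSurjective f]
    [RingHomSurjective g] : IsFiberProduct (f.pullbackFst g) (f.pullbackSnd g) where
  surjective₁ x := by
    obtain ⟨y, hy⟩ := g.surjective (f x)
    exact ⟨⟨(x, y), hy.symm⟩, rfl⟩
  surjective₂ y := by
    obtain ⟨x, hx⟩ := f.surjective (g y)
    exact ⟨⟨(x, y), hx⟩, rfl⟩
  eq_zero x h₁ h₂ := Subtype.ext (Prod.ext h₁ h₂)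
  exists_left y hy := ⟨⟨(y, 0), (map_eq_zero_of_mem_maximalIdeal f hy).trans (map_zero g).symm⟩,
    rfl, rfl⟩
  exists_right y hy := ⟨⟨(0, y), (map_zero f).trans (map_eq_zero_of_mem_maximalIdeal g hy).symm⟩,
    rfl, rfl⟩

end NearlyGorenstein

/-- The ring `f.pullback g` is the fiber product `A = R ×ₖ S`, and `FractionRing A` is its total
ring of fractions, that is, the localization at all nonzerodivisors. -/
theorem theorem5p4 {R S : Type u} {k : Type v}
    [CommRing R] [IsLocalRing R] [CommRing S] [IsLocalRing S] [Field k] [Infinite k]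
    (hR : IsCohenMacaulayLocalRing R) (hS : IsCohenMacaulayLocalRing S)
    (hdimR : ringKrullDim R = 1) (hdimS : ringKrullDim S = 1)
    (f : R →+* k) (g : S →+* k) [RingHomSurjective f] [RingHomSurjective g]
    (hQ : IsGorensteinRing (FractionRing (f.pullback g)))
    (hK : HasCanonicalModule (f.pullback g)) :
    IsNearlyGorenstein (f.pullback g) ↔ IsNearlyGorenstein R ∧ IsNearlyGorenstein S :=
  (isFiberProduct_pullback f g).isNearlyGorenstein_iff hR hS hdimR hdimS hK
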